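/- Let $A=(a_{ij})_{i,j\in\mathcal I}$ be a generalized Cartan matrix with $\mathcal I$ finite, with realisation $(\mathfrak h,\Pi=\{\alpha_i\}_{i\in\mathcal I},\Pi^\vee=\{\alpha_i^\vee\}_{i\in\mathcal I})$ over $\mathbb C$, and let $\mathfrak g=\mathfrak g(A)$ be the Kac–Moody algebra, i.e. the quotient of the Lie algebra generated by $e_i,f_i$ ($i\in\mathcal I$) and $\mathfrak h$ modulo the Chevalley–Serre relations by its largest ideal intersecting $\mathfrak h$ trivially. Let $\Delta\subset\mathfrak h^*$ be its root system and $\Delta^+=\Delta\cap\mathbb Z_{\ge0}\Pi$. For $J\subseteq\mathcal I$ put $J^c=\mathcal I\setminus J$, $\Pi_J=\{\alpha_j: j\in J\}$, $\Delta^+_J=\Delta^+\cap\mathbb Z\Pi_J$ and $$\Delta_{J,1}=\Big\{\beta=\sum_{i\in\mathcal I}c_i\alpha_i\in\Delta:\ \sum_{i\in J}c_i=1\Big\}.$$ For $S\subseteq\mathfrak h^*$, $\mathbb Z_{\ge0}S$ denotes the set of finite sums (including the empty sum $0$) of elements of $S$, and for $C,D\subseteq\mathfrak h^*$, $C-D=\{c-d: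 c\in C,\ d\in D\}$. Let $\lambda\in\mathfrak h^*$ and let $V$ be a nonzero highest weight $\mathfrak g$-module of highest weight $\lambda$. Let $\operatorname{wt}V\subset\mathfrak h^*$ be its set of weights, put $\operatorname{wt}_JV=\operatorname{wt}V\cap(\lambda-\mathbb Z_{\ge0}\Pi_J)$ for $J\subseteq\mathcal I$, and $J_\lambda=\{i\in\mathcal I:\ \langle\lambda,\alpha_i^\vee\rangle\in\mathbb Z_{\ge0}\}$. Then $$\operatorname{wt}V=\operatorname{wt}_{J_\lambda}V-\mathbb Z_{\ge0}\Delta_{J_\lambda^c,1}=\operatorname{wt}_{J_\lambda}V-\mathbb Z_{\ge0}\big(\Delta^+\setminus\Delta^+_{J_\lambda}\big).$$ Moreover, for every $J\subseteq\mathcal I$, $$\operatorname{wt}_JV-\mathbb Z_{\ge0}\Pi_{J^c}\subseteq\operatorname{wt}V\quad\Longleftrightarrow\quad \operatorname{wt}V=\operatorname{wt}_JV-\mathbb Z_{\ge0}\Delta_{J^c,1}.$$ -/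

import Mathlib

open scoped Pointwise

/-- `A` is a generalized Cartan matrix. -/
structure IsGeneralizedCartanMatrix {ι : Type*} (A : Matrix ι ι ℤ) : Prop where
  diag : ∀ i, A i i = 2
  nonpos : ∀ i j, i ≠ j → A i j ≤ 0
  zero_symm : ∀ i j, A i j = 0 → A j i = 0

/-- A (minimal) realisation `(𝔥, Π, Π^∨)` of the matrix `A`: linearly independent simple roots
`root i` in `𝔥^*` and simple coroots `coroot i` in `𝔥` with `⟨α_j, α_i^∨⟩ = A i j`, where
`dim 𝔥 = 2 n - rank A`. -/
structure Realization {ι : Type*} [Fintype ι] (A : Matrix ι ι ℤ)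
    (𝔥 : Type*) [AddCommGroup 𝔥] [Module ℂ 𝔥] where
  coroot : ι → 𝔥
  root : ι → Module.Dual ℂ 𝔥
  linearIndependent_coroot : LinearIndependent ℂ coroot
  linearIndependent_root : LinearIndependent ℂ root
  root_coroot : ∀ i j, root j (coroot i) = (A i j : ℂ)
  finiteDimensional : FiniteDimensional ℂ 𝔥
  finrank_add_rank :
    Module.finrank ℂ 𝔥 + (A.map (Int.cast : ℤ → ℂ)).rank = 2 * Fintype.card ι

namespace KacMoody

/-- Generators `e_i`, `f_i` (`i ∈ ι`) and `h` (`h ∈ 𝔥`). -/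
inductive Gen (ι 𝔥 : Type*)
  | e : ι → Gen ι 𝔥
  | f : ι → Gen ι 𝔥
  | h : 𝔥 → Gen ι 𝔥

section

variable {ι : Type*} [Fintype ι] {A : Matrix ι ι ℤ}
variable {𝔥 : Type*} [AddCommGroup 𝔥] [Module ℂ 𝔥] (r : Realization A 𝔥)

/-- The free Lie algebra on the generators. -/
abbrev Free (ι 𝔥 : Type*) := FreeLieAlgebra ℂ (Gen ι 𝔥)

/-- The generator `e_i` in the free Lie algebra. -/
noncomputable abbrev freeE (𝔥 : Type*) {ι : Type*} (i : ι) : Free ι 𝔥 :=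
  FreeLieAlgebra.of ℂ (Gen.e i)

/-- The generator `f_i` in the free Lie algebra. -/
noncomputable abbrev freeF (𝔥 : Type*) {ι : Type*} (i : ι) : Free ι 𝔥 :=
  FreeLieAlgebra.of ℂ (Gen.f i)

/-- The generator `h ∈ 𝔥` in the free Lie algebra. -/
noncomputable abbrev freeH (ι : Type*) {𝔥 : Type*} (x : 𝔥) : Free ι 𝔥 :=
  FreeLieAlgebra.of ℂ (Gen.h x)

/-- The defining relators of `\bar 𝔤(A)`: `𝔥` is a subspace, the Chevalley relations and the
Serre relations `(ad e_i)^{1 - a_ij} e_j = 0 = (ad f_i)^{1 - a_ij} f_j` for `i ≠ j`. -/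
inductive Relator : Free ι 𝔥 → Prop
  | h_add (x y : 𝔥) : Relator (freeH ι (x + y) - (freeH ι x + freeH ι y))
  | h_smul (c : ℂ) (x : 𝔥) : Relator (freeH ι (c • x) - c • freeH ι x)
  | h_h (x y : 𝔥) : Relator ⁅freeH ι x, freeH ι y⁆
  | e_f_same (i : ι) : Relator (⁅freeE 𝔥 i, freeF 𝔥 i⁆ - freeH ι (r.coroot i))
  | e_f_ne (i j : ι) (hij : i ≠ j) : Relator ⁅freeE 𝔥 i, freeF 𝔥 j⁆
  | h_e (x : 𝔥) (i : ι) : Relator (⁅freeH ι x, freeE 𝔥 i⁆ - r.root i x • freeE 𝔥 i)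
  | h_f (x : 𝔥) (i : ι) : Relator (⁅freeH ι x, freeF 𝔥 i⁆ + r.root i x • freeF 𝔥 i)
  | serre_e (i j : ι) (hij : i ≠ j) :
      Relator (((LieAlgebra.ad ℂ (Free ι 𝔥) (freeE 𝔥 i)) ^ (1 - A i j).toNat) (freeE 𝔥 j))
  | serre_f (i j : ι) (hij : i ≠ j) :
      Relator (((LieAlgebra.ad ℂ (Free ι 𝔥) (freeF 𝔥 i)) ^ (1 - A i j).toNat) (freeF 𝔥 j))

/-- The ideal of the free Lie algebra generated by the relators. -/
noncomputable def relIdeal : LieIdeal ℂ (Free ι 𝔥) :=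
  LieSubmodule.lieSpan ℂ (Free ι 𝔥) {x | Relator r x}

/-- The Lie algebra `\bar 𝔤(A)` defined by the Chevalley–Serre relations. -/
abbrev SerreAlgebra := Free ι 𝔥 ⧸ relIdeal r

/-- The image of a generator in `\bar 𝔤(A)`. -/
noncomputable def serreGen (g : Gen ι 𝔥) : SerreAlgebra r :=
  LieSubmodule.Quotient.mk (FreeLieAlgebra.of ℂ g)

/-- The largest ideal of `\bar 𝔤(A)` that intersects (the image of) `𝔥` trivially, as the sum of
all such ideals. -/
noncomputable def maxIdeal : LieIdeal ℂ (SerreAlgebra r) :=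
  sSup {I | ∀ x : 𝔥, serreGen r (Gen.h x) ∈ I → serreGen r (Gen.h x) = 0}

/-- The Kac–Moody algebra `𝔤 = 𝔤(A)`. -/
abbrev Algebra := SerreAlgebra r ⧸ maxIdeal r

/-- The Chevalley generator `e_i` of `𝔤`. -/
noncomputable def e (i : ι) : Algebra r := LieSubmodule.Quotient.mk (serreGen r (Gen.e i))

/-- The Chevalley generator `f_i` of `𝔤`. -/
noncomputable def f (i : ι) : Algebra r := LieSubmodule.Quotient.mk (serreGen r (Gen.f i))

/-- The element of `𝔤` given by an element of the Cartan subalgebra `𝔥`. -/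
noncomputable def h (x : 𝔥) : Algebra r := LieSubmodule.Quotient.mk (serreGen r (Gen.h x))

/-- The set of weights `wt V` of a `𝔤`-module: all `μ ∈ 𝔥^*` whose weight space
`{v | h • v = μ(h) v for all h ∈ 𝔥}` is nonzero. -/
def wt (V : Type*) [AddCommGroup V] [Module ℂ V] [LieRingModule (Algebra r) V] :
    Set (Module.Dual ℂ 𝔥) :=
  {μ | ∃ v : V, v ≠ 0 ∧ ∀ x : 𝔥, ⁅h r x, v⁆ = μ x • v}

/-- `V` is a (nonzero) highest weight module of highest weight `lam`: it is generated by a nonzero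
vector of weight `lam` that is killed by all `e_i`, hence by `𝔫^+`. -/
def IsHighestWeightModule (lam : Module.Dual ℂ 𝔥) (V : Type*) [AddCommGroup V] [Module ℂ V]
    [LieRingModule (Algebra r) V] [LieModule ℂ (Algebra r) V] : Prop :=
  ∃ v : V, v ≠ 0 ∧ (∀ i, ⁅e r i, v⁆ = 0) ∧ (∀ x : 𝔥, ⁅h r x, v⁆ = lam x • v) ∧
    LieSubmodule.lieSpan ℂ (Algebra r) {v} = ⊤

/-- The root system `Δ`: the nonzero weights of the adjoint representation. -/
def roots : Set (Module.Dual ℂ 𝔥) := wt r (Algebra r) \ {0}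

/-- `ℤ_{≥0} S`, the set of finite sums of elements of `S` (including the empty sum `0`). -/
def natSpan (S : Set (Module.Dual ℂ 𝔥)) : Set (Module.Dual ℂ 𝔥) :=
  (AddSubmonoid.closure S : Set (Module.Dual ℂ 𝔥))

/-- `Π_J = {α_j | j ∈ J}`. -/
def simpleRoots (J : Set ι) : Set (Module.Dual ℂ 𝔥) := r.root '' J

/-- The set `Δ^+` of positive roots: the roots in `ℤ_{≥0} Π`. -/
def posRoots : Set (Module.Dual ℂ 𝔥) := roots r ∩ natSpan (simpleRoots r Set.univ)

/-- `Δ^+_J = Δ^+ ∩ ℤ Π_J`. -/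
def posRootsSub (J : Set ι) : Set (Module.Dual ℂ 𝔥) :=
  posRoots r ∩ (AddSubgroup.closure (simpleRoots r J) : Set (Module.Dual ℂ 𝔥))

/-- `Δ_{I,n}`: the roots `β = ∑ c_i α_i` whose `I`-height `∑_{i ∈ I} c_i` is `n`. The coefficients
are unique, since the simple roots are linearly independent. -/
def rootsOfHeight (I : Set ι) (n : ℤ) : Set (Module.Dual ℂ 𝔥) :=
  {β ∈ roots r | ∃ c : ι → ℂ, β = ∑ i, c i • r.root i ∧ ∑ i, I.indicator c i = (n : ℂ)}

/-- `wt_J V = wt V ∩ (λ - ℤ_{≥0} Π_J)`. -/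
def wtSub (lam : Module.Dual ℂ 𝔥) (J : Set ι) (V : Type*) [AddCommGroup V] [Module ℂ V]
    [LieRingModule (Algebra r) V] : Set (Module.Dual ℂ 𝔥) :=
  wt r V ∩ ({lam} - natSpan (simpleRoots r J))

/-- `J_λ = {i | ⟨λ, α_i^∨⟩ ∈ ℤ_{≥0}}`. -/
def integralSet (lam : Module.Dual ℂ 𝔥) : Set ι := {i | ∃ n : ℕ, lam (r.coroot i) = (n : ℂ)}

end

end KacMoody

/-! Weights of `V` are written `λ - ∑ a_i α_i` with `a` a vector of integers (`IsDepth`). Call a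
positive root outer for `J` if its coefficients outside `J` add up to 1 (`IsOuterRoot`).

Upper bound, for every `J`: bracketing with `f_j`, `j ∈ J`, preserves the span of the iterated
brackets of `f`s with exactly one letter outside `J`. Moving such `f_j` to the right, `V` is spanned
by vectors `x_1 ⋯ x_k m`, where the `x_i` are brackets of this kind and `m` is a product of `f_j`,
`j ∈ J`, applied to the highest weight vector. Reading off weights gives `wt_subset`. The same
decomposition of `𝔫^+` shows that a positive root not supported in `J` is a sum of outer roots, so
both descriptions of `wt V` involve the same monoid (`natSpan_posRoots_diff`).

Lower bound: suppose that simple roots outside `J` can be subtracted freely from `wt_J V`. The heart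
is `sub_sum_mem_of_sub_simple_mem`, which extends this to all outer roots. For a nonsimple outer
root `c` some `c - α_j`, `j ∈ J`, is again outer. If `μ - α_j` is a weight, `α_j` is transferred
from `c` to `μ`. Otherwise `f_j` kills the weight space of `μ`, so `s_j μ` is a weight, and
`𝔰𝔩₂`-theory together with the `s_j`-stability of the outer roots closes an induction on depth. Only
the `e_i` are known to act locally nilpotently on `V`, so its weights need not be stable under
`s_j`.

For `J = J_λ` the assumption holds: if `i ∉ J_λ`, then `e_i^n f_i^n v` is a nonzero multiple of `v`,
and `e_i` commutes with the other `f_j` (`isDepth_add_single`). The converse implication for general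
`J` needs `Π_{J^c} ⊆ Δ_{J^c,1}`, that is, `e_i ≠ 0` in `𝔤(A)`. This is shown by letting the
generators act on words in the `f_i` (`serreData_coroot_ne_zero`) and comparing weights
(`serreData_E_notMem_maxIdeal`). -/

namespace KacMoody

/-! ### Coordinates on the root lattice. -/

section Coordinates

variable {ι : Type*} [Fintype ι] {A : Matrix ι ι ℤ}
variable {𝔥 : Type*} [AddCommGroup 𝔥] [Module ℂ 𝔥] (r : Realization A 𝔥)

/-- The element `∑ c_i α_i` of the root lattice with coordinates `c`. -/
def latticePoint : (ι → ℤ) →+ Module.Dual ℂ 𝔥 where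
  toFun c := ∑ i, c i • r.root i
  map_zero' := by simp
  map_add' c d := by simp [add_smul, Finset.sum_add_distrib]

lemma latticePoint_apply (c : ι → ℤ) : latticePoint r c = ∑ i, c i • r.root i := rfl

lemma latticePoint_eq_complex_sum (c : ι → ℤ) :
    latticePoint r c = ∑ i, (c i : ℂ) • r.root i := by
  simp only [latticePoint_apply, Int.cast_smul_eq_zsmul]

lemma latticePoint_single [DecidableEq ι] (i : ι) (n : ℤ) :
    latticePoint r (Pi.single i n) = n • r.root i := by
  rw [latticePoint_apply, Finset.sum_eq_single i] <;> simp +contextual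

lemma latticePoint_injective : Function.Injective (latticePoint r) := by
  rw [injective_iff_map_eq_zero]
  intro c hc
  rw [latticePoint_eq_complex_sum] at hc
  have := Fintype.linearIndependent_iff.1 r.linearIndependent_root _ hc
  ext i
  exact_mod_cast this i

lemma latticePoint_coroot (c : ι → ℤ) (j : ι) :
    latticePoint r c (r.coroot j) = ((A.mulVec c j : ℤ) : ℂ) := by
  simp [latticePoint_eq_complex_sum, r.root_coroot, Matrix.mulVec, dotProduct, mul_comm]

end Coordinates

/-! ### Lie algebras with Chevalley generators, and their weight spaces. -/

/-- Elements `e_i`, `f_i`, `h` of a Lie algebra satisfying the Chevalley relations. -/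
structure ChevalleyData {ι : Type*} [Fintype ι] {A : Matrix ι ι ℤ} {𝔥 : Type*} [AddCommGroup 𝔥]
    [Module ℂ 𝔥] (r : Realization A 𝔥) (L : Type*) [LieRing L] [LieAlgebra ℂ L] where
  E : ι → L
  F : ι → L
  H : 𝔥 →ₗ[ℂ] L
  lie_H_H : ∀ x y, ⁅H x, H y⁆ = 0
  lie_E_F_same : ∀ i, ⁅E i, F i⁆ = H (r.coroot i)
  lie_E_F_ne : ∀ i j, i ≠ j → ⁅E i, F j⁆ = 0
  lie_H_E : ∀ x i, ⁅H x, E i⁆ = r.root i x • E i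
  lie_H_F : ∀ x i, ⁅H x, F i⁆ = -(r.root i x • F i)

namespace ChevalleyData

variable {ι : Type*} [Fintype ι] {A : Matrix ι ι ℤ}
variable {𝔥 : Type*} [AddCommGroup 𝔥] [Module ℂ 𝔥] {r : Realization A 𝔥}
variable {L : Type*} [LieRing L] [LieAlgebra ℂ L] (D : ChevalleyData r L)
variable (M : Type*) [AddCommGroup M] [Module ℂ M] [LieRingModule L M] [LieModule ℂ L M]

/-- The data with the roles of `e_i` and `f_i` interchanged. -/
@[simps]
def swap : ChevalleyData r L where
  E := D.F
  F := D.E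
  H := -D.H
  lie_H_H x y := by simp [D.lie_H_H]
  lie_E_F_same i := by
    rw [← lie_skew, D.lie_E_F_same]; rfl
  lie_E_F_ne i j hij := by
    rw [← lie_skew, D.lie_E_F_ne _ _ hij.symm, neg_zero]
  lie_H_E x i := by simp [D.lie_H_F]
  lie_H_F x i := by simp [D.lie_H_E]

lemma swap_swap : D.swap.swap = D := by
  cases D
  simp [swap]

/-- The elements `e_i`, `f_i`, `h` generate the Lie algebra. -/
def Generates : Prop :=
  LieSubalgebra.lieSpan ℂ L (Set.range D.E ∪ Set.range D.F ∪ Set.range D.H) = ⊤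

/-- The Serre relations for the `e_i`. -/
def SerreE : Prop :=
  ∀ i j, i ≠ j → ((LieAlgebra.ad ℂ L (D.E i)) ^ (1 - A i j).toNat) (D.E j) = 0

lemma range_neg_H : Set.range (-D.H) = Set.range D.H := by
  ext y
  constructor
  · rintro ⟨x, rfl⟩; exact ⟨-x, by simp⟩
  · rintro ⟨x, rfl⟩; exact ⟨-x, by simp⟩

variable {D} in
lemma Generates.swap (hD : D.Generates) : D.swap.Generates := by
  unfold Generates at hD ⊢
  rw [← hD, swap_H, range_neg_H]
  exact congrArg (fun S => LieSubalgebra.lieSpan ℂ L (S ∪ Set.range D.H)) (Set.union_comm _ _)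

variable {D} in
/-- A subset closed under the Lie algebra operations and containing the generators is everything. -/
lemma Generates.eq_top (hD : D.Generates) (K : LieSubalgebra ℂ L) (hE : ∀ i, D.E i ∈ K)
    (hF : ∀ i, D.F i ∈ K) (hH : ∀ x, D.H x ∈ K) (y : L) : y ∈ K := by
  have : (⊤ : LieSubalgebra ℂ L) ≤ K := by
    rw [← hD, LieSubalgebra.lieSpan_le]
    rintro _ ((⟨i, rfl⟩ | ⟨i, rfl⟩) | ⟨x, rfl⟩)
    exacts [hE i, hF i, hH x]
  exact this trivial

/-- The Lie subalgebra of elements stabilizing a subspace of a Lie module. -/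
def _root_.KacMoody.stabilizer {L : Type*} [LieRing L] [LieAlgebra ℂ L] {M : Type*}
    [AddCommGroup M] [Module ℂ M] [LieRingModule L M] [LieModule ℂ L M] (W : Submodule ℂ M) :
    LieSubalgebra ℂ L where
  carrier := {y | ∀ m ∈ W, ⁅y, m⁆ ∈ W}
  zero_mem' := by intro m hm; simp
  add_mem' := by
    intro a b ha hb m hm
    rw [add_lie]; exact W.add_mem (ha m hm) (hb m hm)
  smul_mem' := by
    intro c a ha m hm
    rw [smul_lie]; exact W.smul_mem _ (ha m hm)
  lie_mem' := by
    intro a b ha hb m hm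
    rw [lie_lie]; exact W.sub_mem (ha _ (hb m hm)) (hb _ (ha m hm))

variable {D M} in
lemma Generates.lie_mem (hD : D.Generates) {W : Submodule ℂ M}
    (hE : ∀ i, ∀ m ∈ W, ⁅D.E i, m⁆ ∈ W) (hF : ∀ i, ∀ m ∈ W, ⁅D.F i, m⁆ ∈ W)
    (hH : ∀ x, ∀ m ∈ W, ⁅D.H x, m⁆ ∈ W) (y : L) {m : M} (hm : m ∈ W) : ⁅y, m⁆ ∈ W :=
  hD.eq_top (stabilizer W) hE hF hH y m hm

/-- The weight space of weight `μ`. -/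
def weightSpace (μ : Module.Dual ℂ 𝔥) : Submodule ℂ M where
  carrier := {m | ∀ x, ⁅D.H x, m⁆ = μ x • m}
  zero_mem' := by intro x; simp
  add_mem' := by intro a b ha hb x; rw [lie_add, ha, hb, smul_add]
  smul_mem' := by intro c a ha x; rw [lie_smul, ha, smul_comm]

variable {M}

lemma mem_weightSpace {μ : Module.Dual ℂ 𝔥} {m : M} :
    m ∈ D.weightSpace M μ ↔ ∀ x, ⁅D.H x, m⁆ = μ x • m := Iff.rfl

lemma swap_weightSpace (μ : Module.Dual ℂ 𝔥) :
    D.swap.weightSpace M μ = D.weightSpace M (-μ) := by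
  ext m
  simp only [mem_weightSpace, swap_H, LinearMap.neg_apply, neg_lie, neg_smul]
  exact forall_congr' fun x => neg_eq_iff_eq_neg

/-- The operators of `𝔥` commute, so their simultaneous generalized eigenspaces are independent, and
weight spaces are contained in these. -/
lemma iSupIndep_weightSpace : iSupIndep (D.weightSpace M) := by
  have h := Module.End.independent_iInf_maxGenEigenspace_of_forall_mapsTo
    (fun x : 𝔥 => LieModule.toEnd ℂ L M (D.H x)) (fun i j φ =>
      Module.End.mapsTo_maxGenEigenspace_of_comm (by
        ext m
        have h := leibniz_lie (D.H j) (D.H i) m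
        rwa [D.lie_H_H, zero_lie, zero_add] at h) φ)
  have h2 := h.comp (f := fun μ : Module.Dual ℂ 𝔥 => (μ : 𝔥 → ℂ)) DFunLike.coe_injective
  refine h2.mono fun μ m hm => ?_
  simp only [Function.comp, Submodule.mem_iInf]
  exact fun x => Module.End.eigenspace_le_maxGenEigenspace (Module.End.mem_eigenspace_iff.2 (hm x))

/-- A nonzero weight vector in the span of a set of weight vectors is in the span of those of the
same weight; in particular there is such a nonzero element. -/
lemma exists_of_mem_span (Q : Module.Dual ℂ 𝔥 → M → Prop)
    (hQ : ∀ μ m, Q μ m → m ∈ D.weightSpace M μ) {μ : Module.Dual ℂ 𝔥} {y : M}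
    (hy : y ∈ D.weightSpace M μ) (hy0 : y ≠ 0) (hspan : y ∈ Submodule.span ℂ {m | ∃ ν, Q ν m}) :
    ∃ m, Q μ m ∧ m ≠ 0 := by
  by_contra! hcon
  have hle : Submodule.span ℂ {m | ∃ ν, Q ν m} ≤ ⨆ (ν) (_ : ν ≠ μ), D.weightSpace M ν := by
    rw [Submodule.span_le]
    rintro m ⟨ν, hm⟩
    by_cases h : ν = μ
    · subst h; rw [hcon m hm]; exact zero_mem _
    · exact Submodule.mem_iSup_of_mem ν (Submodule.mem_iSup_of_mem h (hQ ν m hm))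
  exact hy0 (Submodule.disjoint_def.1 (D.iSupIndep_weightSpace (M := M) μ) y hy (hle hspan))

lemma lie_E_mem {μ : Module.Dual ℂ 𝔥} {m : M} (hm : m ∈ D.weightSpace M μ) (i : ι) :
    ⁅D.E i, m⁆ ∈ D.weightSpace M (μ + r.root i) := by
  intro x
  rw [leibniz_lie, hm x, D.lie_H_E, smul_lie, lie_smul, LinearMap.add_apply, add_smul, add_comm]

lemma lie_F_mem {μ : Module.Dual ℂ 𝔥} {m : M} (hm : m ∈ D.weightSpace M μ) (i : ι) :
    ⁅D.F i, m⁆ ∈ D.weightSpace M (μ - r.root i) := by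
  intro x
  rw [leibniz_lie, hm x, D.lie_H_F, neg_lie, smul_lie, lie_smul, LinearMap.sub_apply, sub_smul]
  abel

lemma lie_mem_weightSpace {μ ν : Module.Dual ℂ 𝔥} {y : L} {m : M} (hy : y ∈ D.weightSpace L ν)
    (hm : m ∈ D.weightSpace M μ) : ⁅y, m⁆ ∈ D.weightSpace M (ν + μ) := by
  intro x
  rw [leibniz_lie, hm x, hy x, smul_lie, lie_smul, LinearMap.add_apply, add_smul]

/-! ### `𝔰𝔩₂`-theory along a root string. -/

/-- The action of `e_i` on a Lie module. -/
abbrev opE (M : Type*) [AddCommGroup M] [Module ℂ M] [LieRingModule L M] [LieModule ℂ L M]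
    (i : ι) : Module.End ℂ M := LieModule.toEnd ℂ L M (D.E i)

/-- The action of `f_i` on a Lie module. -/
abbrev opF (M : Type*) [AddCommGroup M] [Module ℂ M] [LieRingModule L M] [LieModule ℂ L M]
    (i : ι) : Module.End ℂ M := LieModule.toEnd ℂ L M (D.F i)

lemma opF_pow_mem {μ : Module.Dual ℂ 𝔥} {m : M} (hm : m ∈ D.weightSpace M μ) (i : ι) (n : ℕ) :
    (D.opF M i ^ n) m ∈ D.weightSpace M (μ - n • r.root i) := by
  induction n with
  | zero => simpa using hm
  | succ n ih =>
    rw [pow_succ', Module.End.mul_apply]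
    have := D.lie_F_mem ih i
    rwa [sub_sub, ← succ_nsmul] at this

lemma opE_pow_mem {μ : Module.Dual ℂ 𝔥} {m : M} (hm : m ∈ D.weightSpace M μ) (i : ι) (n : ℕ) :
    (D.opE M i ^ n) m ∈ D.weightSpace M (μ + n • r.root i) := by
  induction n with
  | zero => simpa using hm
  | succ n ih =>
    rw [pow_succ', Module.End.mul_apply]
    have := D.lie_E_mem ih i
    rwa [add_assoc, ← succ_nsmul] at this

/-- The `𝔰𝔩₂` formula `e f^{n+1} m = (n+1) (μ(h) - n) f^n m` for a vector `m` killed by `e`. -/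
lemma lie_E_opF_pow (hA : IsGeneralizedCartanMatrix A) {μ : Module.Dual ℂ 𝔥} {m : M}
    (hm : m ∈ D.weightSpace M μ) (i : ι) (h0 : ⁅D.E i, m⁆ = 0) (n : ℕ) :
    ⁅D.E i, (D.opF M i ^ (n + 1)) m⁆ =
      ((n + 1 : ℂ) * (μ (r.coroot i) - n)) • (D.opF M i ^ n) m := by
  have key : ∀ y : M, ⁅D.E i, ⁅D.F i, y⁆⁆ = ⁅D.H (r.coroot i), y⁆ + ⁅D.F i, ⁅D.E i, y⁆⁆ := by
    intro y; rw [leibniz_lie, D.lie_E_F_same]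
  induction n with
  | zero =>
    simp only [zero_add, pow_one, pow_zero, Module.End.one_apply, LieModule.toEnd_apply_apply]
    rw [key, h0, lie_zero, add_zero, hm]; simp
  | succ n ih =>
    rw [pow_succ', Module.End.mul_apply, LieModule.toEnd_apply_apply, key, ih,
      D.opF_pow_mem hm i (n + 1), lie_smul, ← LieModule.toEnd_apply_apply ℂ L M (D.F i),
      ← Module.End.mul_apply, ← pow_succ', ← add_smul]
    congr 1
    have : r.root i (r.coroot i) = 2 := by rw [r.root_coroot, hA.diag]; norm_num
    simp only [LinearMap.sub_apply, LinearMap.smul_apply, this, nsmul_eq_mul]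
    push_cast
    ring

lemma opF_pow_ne_zero (hA : IsGeneralizedCartanMatrix A) {μ : Module.Dual ℂ 𝔥} {m : M}
    (hm : m ∈ D.weightSpace M μ) (hm0 : m ≠ 0) (i : ι) (h0 : ⁅D.E i, m⁆ = 0) (n : ℕ)
    (hn : ∀ k < n, μ (r.coroot i) ≠ (k : ℂ)) : (D.opF M i ^ n) m ≠ 0 := by
  induction n with
  | zero => simpa using hm0
  | succ n ih =>
    intro hcon
    have h := D.lie_E_opF_pow hA hm i h0 n
    rw [hcon, lie_zero, eq_comm, smul_eq_zero] at h
    rcases h with h | h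
    · rcases mul_eq_zero.1 h with h | h
      · exact Nat.cast_add_one_ne_zero n h
      · exact hn n (by omega) (sub_eq_zero.1 h)
    · exact ih (fun k hk => hn k (by omega)) h

/-- If `e_i` acts nilpotently on a vector of weight `μ` and `μ(α_i^∨)` is not an integer `< m`,
then `μ - m α_i` is a weight. -/
lemma weightSpace_sub_ne_bot (hA : IsGeneralizedCartanMatrix A) {μ : Module.Dual ℂ 𝔥} {y : M}
    (hy : y ∈ D.weightSpace M μ) (hy0 : y ≠ 0) (i : ι) (hnil : ∃ N : ℕ, (D.opE M i ^ N) y = 0)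
    (m : ℕ) (hm : ∀ n : ℤ, n < m → μ (r.coroot i) ≠ (n : ℂ)) :
    ∃ z ∈ D.weightSpace M (μ - m • r.root i), z ≠ 0 := by
  classical
  obtain ⟨k, hk⟩ : ∃ k, Nat.find hnil = k + 1 := by
    refine Nat.exists_eq_succ_of_ne_zero fun h => ?_
    have := Nat.find_spec hnil
    rw [h] at this; exact hy0 (by simpa using this)
  -- The top `e_i^k y` of the string is killed by `e_i`. Descending from it by `k + m` steps fails
  -- only if `μ(α_i^∨) + 2k` is a natural number `< k + m`, which makes `μ(α_i^∨)` an integer `< m -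
  -- k ≤ m`.
  have h1 : (D.opE M i ^ k) y ≠ 0 := Nat.find_min hnil (by omega)
  have h2 : ⁅D.E i, (D.opE M i ^ k) y⁆ = 0 := by
    have := Nat.find_spec hnil
    rwa [hk, pow_succ', Module.End.mul_apply] at this
  have h3 := D.opE_pow_mem hy i k
  refine ⟨(D.opF M i ^ (k + m)) ((D.opE M i ^ k) y), ?_, ?_⟩
  · have := D.opF_pow_mem h3 i (k + m)
    rwa [add_smul, show μ + k • r.root i - (k • r.root i + m • r.root i) = μ - m • r.root i by abel]
      at this
  · refine D.opF_pow_ne_zero hA h3 h1 i h2 _ fun n hn h => ?_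
    have h2' : r.root i (r.coroot i) = 2 := by rw [r.root_coroot, hA.diag]; norm_num
    simp only [LinearMap.add_apply, LinearMap.smul_apply, h2', nsmul_eq_mul] at h
    refine hm (n - 2 * k) (by omega) ?_
    push_cast
    linear_combination h

/-- If `f_i` kills a nonzero vector of weight `μ` on which `e_i` acts nilpotently, then
`μ(α_i^∨) = -n` with `n ∈ ℕ`, and `μ + n α_i` is a weight. -/
lemma exists_of_lie_F_eq_zero (hA : IsGeneralizedCartanMatrix A) {μ : Module.Dual ℂ 𝔥} {y : M}
    (hy : y ∈ D.weightSpace M μ) (hy0 : y ≠ 0) (i : ι) (hnil : ∃ N : ℕ, (D.opE M i ^ N) y = 0)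
    (hF : ⁅D.F i, y⁆ = 0) :
    ∃ n : ℕ, μ (r.coroot i) = -(n : ℂ) ∧ ∃ z ∈ D.weightSpace M (μ + n • r.root i), z ≠ 0 := by
  obtain ⟨N, hN⟩ := hnil
  -- With `e_i` and `f_i` interchanged, `y` is a highest weight vector. Nilpotency of `e_i` then
  -- forces `-μ(α_i^∨) ∈ ℕ`.
  have hy' : y ∈ D.swap.weightSpace M (-μ) := by rwa [swap_weightSpace, neg_neg]
  obtain ⟨k, hk⟩ : ∃ k : ℕ, μ (r.coroot i) = -(k : ℂ) := by
    by_contra! hcon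
    refine D.swap.opF_pow_ne_zero hA hy' hy0 i hF N (fun k _ h => hcon k ?_) hN
    simpa using congrArg Neg.neg h
  refine ⟨k, hk, _, D.opE_pow_mem hy i k, ?_⟩
  refine D.swap.opF_pow_ne_zero hA hy' hy0 i hF k (fun n hn h => ?_)
  rw [LinearMap.neg_apply, hk, neg_neg] at h
  exact absurd (Nat.cast_injective h) (by omega)

end ChevalleyData

end KacMoody

/-! ### Height outside `J`, and iterated brackets of generators. -/

namespace KacMoody

section Coordinates

variable {ι : Type*} [Fintype ι] {J : Set ι}

variable (J) in
/-- The sum of the coordinates outside `J`. -/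
noncomputable def outerHeight : (ι → ℤ) →+ ℤ := by
  classical exact
  { toFun := fun c => ∑ i, if i ∈ J then 0 else c i
    map_zero' := by simp
    map_add' := fun c d => by
      rw [← Finset.sum_add_distrib]
      refine Finset.sum_congr rfl fun i _ => ?_
      split_ifs <;> simp }

open Classical in
lemma outerHeight_apply (c : ι → ℤ) :
    outerHeight J c = ∑ i, if i ∈ J then 0 else c i := rfl

lemma outerHeight_single_of_mem [DecidableEq ι] {i : ι} (hi : i ∈ J) (n : ℤ) :
    outerHeight J (Pi.single i n) = 0 := by
  rw [outerHeight_apply]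
  refine Finset.sum_eq_zero fun k _ => ?_
  split_ifs with h
  · rfl
  · exact Pi.single_eq_of_ne (by rintro rfl; exact h hi) _

lemma outerHeight_single_of_notMem [DecidableEq ι] {i : ι} (hi : i ∉ J) (n : ℤ) :
    outerHeight J (Pi.single i n) = n := by
  rw [outerHeight_apply, Finset.sum_eq_single i]
  · simp [hi]
  · intro k _ hk
    split_ifs with h
    · rfl
    · exact Pi.single_eq_of_ne hk _
  · simp

lemma outerHeight_nonneg {c : ι → ℤ} (hc : 0 ≤ c) : 0 ≤ outerHeight J c := by
  classical
  rw [outerHeight_apply]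
  refine Finset.sum_nonneg fun k _ => ?_
  split_ifs
  · rfl
  · exact hc k

lemma exists_pos_of_outerHeight {c : ι → ℤ} (hc : 0 < outerHeight J c) :
    ∃ i, i ∉ J ∧ 0 < c i := by
  classical
  rw [outerHeight_apply] at hc
  obtain ⟨i, -, hi⟩ := Finset.exists_lt_of_sum_lt (s := Finset.univ) (f := fun _ : ι => (0 : ℤ))
    (by simpa using hc)
  by_cases h : i ∈ J
  · simp [h] at hi
  · exact ⟨i, h, by simpa [h] using hi⟩

end Coordinates

/-- To show that an operator maps a span to a submodule it suffices to check the generators. -/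
lemma lie_mem_of_span {L M : Type*} [LieRing L] [LieAlgebra ℂ L] [AddCommGroup M]
    [Module ℂ M] [LieRingModule L M] [LieModule ℂ L M] {S : Set M} {W : Submodule ℂ M} (y : L)
    (h : ∀ m ∈ S, ⁅y, m⁆ ∈ W) {m : M} (hm : m ∈ Submodule.span ℂ S) : ⁅y, m⁆ ∈ W := by
  have : Submodule.span ℂ S ≤ W.comap (LieModule.toEnd ℂ L M y : M →ₗ[ℂ] M) :=
    Submodule.span_le.2 h
  exact this hm

lemma mem_span_of_exists {M κ : Type*} [AddCommGroup M] [Module ℂ M]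
    {Q : κ → M → Prop} {c : κ} {x : M} (h : Q c x) :
    x ∈ Submodule.span ℂ {m | ∃ c, Q c m} := Submodule.subset_span ⟨c, h⟩

namespace ChevalleyData

variable {ι : Type*} [Fintype ι] [DecidableEq ι] {A : Matrix ι ι ℤ}
variable {𝔥 : Type*} [AddCommGroup 𝔥] [Module ℂ 𝔥] {r : Realization A 𝔥}
variable {L : Type*} [LieRing L] [LieAlgebra ℂ L] (D : ChevalleyData r L)
variable {M : Type*} [AddCommGroup M] [Module ℂ M] [LieRingModule L M] [LieModule ℂ L M]

/-- Iterated brackets `[e_{j_1}, [e_{j_2}, …, [e_{j_n}, e_i]]]` with `i ∈ K` and all `j_k ∈ J`,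
together with the coordinates of their weight. -/
inductive Word (K J : Set ι) : (ι → ℤ) → L → Prop
  | base (i : ι) (hi : i ∈ K) : Word K J (Pi.single i 1) (D.E i)
  | step (j : ι) (hj : j ∈ J) {c : ι → ℤ} {x : L} (hx : Word K J c x) :
      Word K J (c + Pi.single j 1) ⁅D.E j, x⁆

/-- Iterated brackets `[x_1, [x_2, …, x_n]]` of words `x_k` with exactly one letter outside `J`. -/
inductive WordProd (J : Set ι) : (ι → ℤ) → L → Prop
  | base {c : ι → ℤ} {x : L} (hx : D.Word Jᶜ J c x) : WordProd J c x
  | step {c d : ι → ℤ} {x y : L} (hx : D.Word Jᶜ J c x) (hy : WordProd J d y) :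
      WordProd J (c + d) ⁅x, y⁆

variable {D} {K J : Set ι}

lemma Word.mem_weightSpace {c : ι → ℤ} {x : L} (h : D.Word K J c x) :
    x ∈ D.weightSpace L (latticePoint r c) := by
  induction h with
  | base i hi => intro y; rw [latticePoint_single, one_smul, D.lie_H_E]
  | step j hj hx ih =>
    rw [map_add, latticePoint_single, one_smul]
    exact D.lie_E_mem ih j

lemma WordProd.mem_weightSpace {c : ι → ℤ} {x : L} (h : D.WordProd J c x) :
    x ∈ D.weightSpace L (latticePoint r c) := by
  induction h with
  | base hx => exact hx.mem_weightSpace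
  | step hx hy ih =>
    rw [map_add]
    exact D.lie_mem_weightSpace hx.mem_weightSpace ih

lemma Word.nonneg {c : ι → ℤ} {x : L} (h : D.Word K J c x) : 0 ≤ c := by
  induction h with
  | base i hi => exact Pi.single_nonneg.2 zero_le_one
  | step j hj hx ih => exact add_nonneg ih (Pi.single_nonneg.2 zero_le_one)

lemma Word.ne_zero {c : ι → ℤ} {x : L} (h : D.Word K J c x) : c ≠ 0 := by
  cases h with
  | base i hi => intro h; simpa using congrFun h i
  | step j hj hx =>
    intro h
    have h1 := congrFun h j
    have h2 := hx.nonneg j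
    simp at h1 h2
    omega

lemma Word.apply_eq_zero {c : ι → ℤ} {x : L} (h : D.Word J J c x) {i : ι} (hi : i ∉ J) :
    c i = 0 := by
  induction h with
  | base j hj => exact Pi.single_eq_of_ne (by rintro rfl; exact hi hj) _
  | step j hj hx ih =>
    rw [Pi.add_apply, ih, zero_add]; exact Pi.single_eq_of_ne (by rintro rfl; exact hi hj) _

lemma Word.mono {K' J' : Set ι} (hK : K ⊆ K') (hJ : J ⊆ J') {c : ι → ℤ} {x : L}
    (h : D.Word K J c x) : D.Word K' J' c x := by
  induction h with
  | base i hi => exact .base i (hK hi)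
  | step j hj hx ih => exact .step j (hJ hj) ih

lemma Word.outerHeight_eq_zero {c : ι → ℤ} {x : L} (h : D.Word J J c x) :
    outerHeight J c = 0 := by
  induction h with
  | base i hi => exact outerHeight_single_of_mem hi 1
  | step j hj hx ih => rw [map_add, ih, outerHeight_single_of_mem hj, add_zero]

lemma Word.outerHeight_eq_one {c : ι → ℤ} {x : L} (h : D.Word Jᶜ J c x) :
    outerHeight J c = 1 := by
  induction h with
  | base i hi => exact outerHeight_single_of_notMem hi 1
  | step j hj hx ih => rw [map_add, ih, outerHeight_single_of_mem hj, add_zero]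

lemma WordProd.outerHeight_pos {c : ι → ℤ} {x : L} (h : D.WordProd J c x) :
    1 ≤ outerHeight J c := by
  induction h with
  | base hx => exact hx.outerHeight_eq_one.ge
  | step hx hy ih => rw [map_add, hx.outerHeight_eq_one]; omega

lemma WordProd.word_of_outerHeight_eq_one {c : ι → ℤ} {x : L} (h : D.WordProd J c x)
    (hc : outerHeight J c = 1) : D.Word Jᶜ J c x := by
  cases h with
  | base hx => exact hx
  | step hx hy =>
    have := hy.outerHeight_pos
    rw [map_add, hx.outerHeight_eq_one] at hc
    omega

/-- The `e`-words, the elements of `𝔥` and the `f`-words, with the coordinates of their weight. -/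
inductive TriangularWord (D : ChevalleyData r L) : (ι → ℤ) → L → Prop
  | pos {c : ι → ℤ} {x : L} (hx : D.Word Set.univ Set.univ c x) : TriangularWord D c x
  | zero (x : 𝔥) : TriangularWord D 0 (D.H x)
  | neg {c : ι → ℤ} {x : L} (hx : D.swap.Word Set.univ Set.univ c x) : TriangularWord D (-c) x

lemma TriangularWord.mem_weightSpace {c : ι → ℤ} {x : L} (h : D.TriangularWord c x) :
    x ∈ D.weightSpace L (latticePoint r c) := by
  cases h with
  | pos hx => exact hx.mem_weightSpace
  | zero x => intro y; simp [D.lie_H_H]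
  | neg hx => rw [map_neg, ← swap_weightSpace]; exact hx.mem_weightSpace

lemma TriangularWord.swap {c : ι → ℤ} {x : L} (h : D.swap.TriangularWord c x) :
    D.TriangularWord (-c) x := by
  cases h with
  | pos hx => exact .neg hx
  | zero x =>
    rw [swap_H, LinearMap.neg_apply, ← map_neg, neg_zero]; exact .zero (-x)
  | neg hx => rw [neg_neg]; exact .pos (by rwa [swap_swap] at hx)

/-- As a derivation, `ad f_i` sends each letter `e_j` to `0` or into `𝔥`, and `𝔥` acts on words by
scalars. -/
lemma lie_F_word {c : ι → ℤ} {x : L} (h : D.Word Set.univ Set.univ c x) (i : ι) :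
    ⁅D.F i, x⁆ ∈ Submodule.span ℂ {m | ∃ c, D.TriangularWord c m} := by
  have haux : ∀ j, ⁅D.F i, D.E j⁆ = 0 ∨ ∃ y, ⁅D.F i, D.E j⁆ = D.H y := by
    intro j
    by_cases hij : j = i
    · subst hij
      right
      exact ⟨-r.coroot j, by rw [← lie_skew, D.lie_E_F_same, map_neg]⟩
    · left
      rw [← lie_skew, D.lie_E_F_ne _ _ hij, neg_zero]
  cases h with
  | base j hj =>
    rcases haux j with h | ⟨y, h⟩ <;> rw [h]
    · exact zero_mem _
    · exact mem_span_of_exists (.zero y)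
  | @step j hj c x hx =>
    rw [leibniz_lie]
    refine add_mem ?_ ?_
    · rcases haux j with h | ⟨y, h⟩ <;> rw [h]
      · simp
      · rw [hx.mem_weightSpace y]
        exact Submodule.smul_mem _ _ (mem_span_of_exists (.pos hx))
    -- The induction runs with `f`-words excluded from the target: brackets of `e_j` with `f`-words
    -- are not yet under control.
    · have aux : ∀ {c x}, D.Word Set.univ Set.univ c x →
          ⁅D.F i, x⁆ ∈ Submodule.span ℂ ({m | ∃ c, D.Word Set.univ Set.univ c m} ∪
            Set.range D.H) := by
        intro c x hx
        induction hx with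
        | base j hj =>
          rcases haux j with h | ⟨y, h⟩ <;> rw [h]
          · exact zero_mem _
          · exact Submodule.subset_span (.inr ⟨y, rfl⟩)
        | @step j hj c x hx ih =>
          rw [leibniz_lie]
          refine add_mem ?_ ?_
          · rcases haux j with h | ⟨y, h⟩ <;> rw [h]
            · simp
            · rw [hx.mem_weightSpace y]
              exact Submodule.smul_mem _ _ (Submodule.subset_span (.inl ⟨_, hx⟩))
          · refine lie_mem_of_span _ ?_ ih
            rintro m (⟨d, hd⟩ | ⟨y, rfl⟩)
            · exact Submodule.subset_span (.inl ⟨_, .step j hj hd⟩)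
            · rw [← lie_skew, D.lie_H_E]
              exact neg_mem (Submodule.smul_mem _ _ (Submodule.subset_span (.inl ⟨_, .base j hj⟩)))
      refine lie_mem_of_span _ ?_ (aux hx)
      rintro m (⟨d, hd⟩ | ⟨y, rfl⟩)
      · exact mem_span_of_exists (.pos (.step j hj hd))
      · rw [← lie_skew, D.lie_H_E]
        exact neg_mem (Submodule.smul_mem _ _ (mem_span_of_exists (.pos (.base j hj))))

lemma lie_E_triangularWord {c : ι → ℤ} {x : L} (h : D.TriangularWord c x) (i : ι) :
    ⁅D.E i, x⁆ ∈ Submodule.span ℂ {m | ∃ c, D.TriangularWord c m} := by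
  cases h with
  | pos hx => exact mem_span_of_exists (.pos (.step i (Set.mem_univ i) hx))
  | zero x =>
    rw [← lie_skew, D.lie_H_E]
    exact neg_mem (Submodule.smul_mem _ _ (mem_span_of_exists (.pos (.base i trivial))))
  | neg hx =>
    -- For the interchanged data, `e_i` plays the role of `f_i` and `x` is an `e`-word.
    refine Submodule.span_mono ?_ (lie_F_word hx i)
    rintro m ⟨c, hc⟩
    exact ⟨-c, hc.swap⟩

/-- The span is stable under brackets with generators, hence under all brackets; so it is a
subalgebra, and it contains the generators. This is the triangular decomposition, without
directness. -/
lemma Generates.span_triangularWord (hD : D.Generates) (y : L) :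
    y ∈ Submodule.span ℂ {m | ∃ c, D.TriangularWord c m} := by
  have hE : ∀ i, ∀ m ∈ Submodule.span ℂ {m | ∃ c, D.TriangularWord c m},
      ⁅D.E i, m⁆ ∈ Submodule.span ℂ {m | ∃ c, D.TriangularWord c m} := by
    intro i m hm
    refine lie_mem_of_span _ ?_ hm
    rintro m ⟨c, hc⟩
    exact lie_E_triangularWord hc i
  have hF : ∀ i, ∀ m ∈ Submodule.span ℂ {m | ∃ c, D.TriangularWord c m},
      ⁅D.F i, m⁆ ∈ Submodule.span ℂ {m | ∃ c, D.TriangularWord c m} := by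
    intro i m hm
    refine lie_mem_of_span _ ?_ hm
    rintro m ⟨c, hc⟩
    have h1 : D.swap.TriangularWord (-c) m := TriangularWord.swap (D := D.swap) (by rwa [swap_swap])
    refine Submodule.span_mono ?_ (lie_E_triangularWord h1 i)
    rintro m ⟨c, hc⟩
    exact ⟨-c, hc.swap⟩
  have hH : ∀ x, ∀ m ∈ Submodule.span ℂ {m | ∃ c, D.TriangularWord c m},
      ⁅D.H x, m⁆ ∈ Submodule.span ℂ {m | ∃ c, D.TriangularWord c m} := by
    intro i m hm
    refine lie_mem_of_span _ ?_ hm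
    rintro m ⟨c, hc⟩
    rw [hc.mem_weightSpace]
    exact Submodule.smul_mem _ _ (mem_span_of_exists hc)
  let K : LieSubalgebra ℂ L :=
    { Submodule.span ℂ {m | ∃ c, D.TriangularWord c m} with
      lie_mem' := fun {a b} _ hb => hD.lie_mem hE hF hH a hb }
  refine hD.eq_top K (fun i => ?_) (fun i => ?_) (fun x => ?_) y
  · exact mem_span_of_exists (.pos (.base i trivial))
  · exact mem_span_of_exists (.neg (.base (D := D.swap) i trivial))
  · exact mem_span_of_exists (.zero x)

/-- A weight of the adjoint representation is represented by a nonzero word. -/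
lemma Generates.exists_triangularWord (hD : D.Generates) {β : Module.Dual ℂ 𝔥} {y : L}
    (hy : y ∈ D.weightSpace L β) (hy0 : y ≠ 0) :
    ∃ c x, β = latticePoint r c ∧ D.TriangularWord c x ∧ x ≠ 0 := by
  obtain ⟨x, ⟨c, rfl, hc⟩, hx⟩ := D.exists_of_mem_span
    (fun μ m => ∃ c, μ = latticePoint r c ∧ D.TriangularWord c m)
    (by rintro μ m ⟨c, rfl, hc⟩; exact hc.mem_weightSpace) hy hy0 (by
      refine Submodule.span_mono ?_ (hD.span_triangularWord y)
      rintro m ⟨c, hc⟩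
      exact ⟨_, c, rfl, hc⟩)
  exact ⟨c, x, rfl, hc, hx⟩

/-- Iterated brackets of letters in `J` preserve the span of the words with one letter
outside `J`. -/
lemma Word.lie_word_mem {c : ι → ℤ} {z : L} (hz : D.Word J J c z) {d : ι → ℤ} {w : L}
    (hw : D.Word Jᶜ J d w) : ⁅z, w⁆ ∈ Submodule.span ℂ {m | ∃ c, D.Word Jᶜ J c m} := by
  induction hz generalizing d w with
  | base j hj => exact mem_span_of_exists (.step j hj hw)
  | step j hj hx ih =>
    rw [lie_lie]
    refine sub_mem ?_ (ih (.step j hj hw))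
    refine lie_mem_of_span _ ?_ (ih hw)
    rintro m ⟨c, hc⟩
    exact mem_span_of_exists (.step j hj hc)

lemma WordProd.lie_E_mem {c : ι → ℤ} {x : L} (hx : D.WordProd J c x) (i : ι) :
    ⁅D.E i, x⁆ ∈ Submodule.span ℂ {m | ∃ c, D.WordProd J c m} := by
  by_cases hi : i ∈ J
  · induction hx with
    | base hx => exact mem_span_of_exists (.base (.step i hi hx))
    | step hw hp ih =>
      rw [leibniz_lie]
      refine add_mem (mem_span_of_exists (.step (.step i hi hw) hp)) ?_
      refine lie_mem_of_span _ ?_ ih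
      rintro m ⟨c, hc⟩
      exact mem_span_of_exists (.step hw hc)
  · exact mem_span_of_exists (.step (.base i hi) hx)

/-- This splits `𝔫^+` into the part generated by the letters in `J` and the part generated by
brackets with one letter outside `J`. -/
lemma Word.mem_span_wordProd {c : ι → ℤ} {x : L} (hx : D.Word Set.univ Set.univ c x) :
    x ∈ Submodule.span ℂ {m | ∃ c, D.Word J J c m ∨ D.WordProd J c m} := by
  induction hx with
  | base i _ =>
    by_cases hi : i ∈ J
    · exact Submodule.subset_span ⟨_, .inl (.base i hi)⟩
    · exact Submodule.subset_span ⟨_, .inr (.base (.base i hi))⟩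
  | step i _ hx ih =>
    refine lie_mem_of_span _ ?_ ih
    rintro m ⟨c, hc | hc⟩
    · by_cases hi : i ∈ J
      · exact Submodule.subset_span ⟨_, .inl (.step i hi hc)⟩
      -- Up to sign this is a `J`-word acting on the one-letter word `e_i`, `i ∉ J`.
      · rw [← lie_skew]
        refine neg_mem (Submodule.span_mono ?_ (hc.lie_word_mem (.base i hi)))
        rintro m ⟨c, hc⟩
        exact ⟨c, .inr (.base hc)⟩
    · refine Submodule.span_mono ?_ (hc.lie_E_mem i)
      rintro m ⟨c, hc⟩
      exact ⟨c, .inr hc⟩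

/-- A nonzero word involving a letter outside `J` has the weight of a nonzero product of words
with exactly one letter outside `J`. -/
lemma Word.exists_wordProd {c : ι → ℤ} {x : L} (hx : D.Word Set.univ Set.univ c x) (hx0 : x ≠ 0)
    (hc : 1 ≤ outerHeight J c) : ∃ y, D.WordProd J c y ∧ y ≠ 0 := by
  obtain ⟨y, ⟨d, hd, h⟩, hy⟩ := D.exists_of_mem_span
    (fun μ m => ∃ c, μ = latticePoint r c ∧ (D.Word J J c m ∨ D.WordProd J c m))
    (by
      rintro μ m ⟨c, rfl, hc | hc⟩
      exacts [hc.mem_weightSpace, hc.mem_weightSpace]) hx.mem_weightSpace hx0 (by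
      refine Submodule.span_mono ?_ (hx.mem_span_wordProd (J := J))
      rintro m ⟨c, hc⟩
      exact ⟨_, c, rfl, hc⟩)
  obtain rfl := latticePoint_injective r hd
  rcases h with h | h
  · rw [h.outerHeight_eq_zero] at hc; omega
  · exact ⟨y, h, hy⟩

/-- The coordinates of the nonzero weights of the adjoint representation. -/
def IsRoot (D : ChevalleyData r L) (c : ι → ℤ) : Prop :=
  c ≠ 0 ∧ ∃ y ∈ D.weightSpace L (latticePoint r c), y ≠ 0

lemma Generates.exists_word (hD : D.Generates) {c : ι → ℤ} (hc : D.IsRoot c)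
    (hpos : ∃ i, 0 < c i) : ∃ x, D.Word Set.univ Set.univ c x ∧ x ≠ 0 := by
  obtain ⟨hc0, y, hy, hy0⟩ := hc
  obtain ⟨d, x, hd, hx, hx0⟩ := hD.exists_triangularWord hy hy0
  obtain rfl := latticePoint_injective r hd
  cases hx with
  | pos hx => exact ⟨x, hx, hx0⟩
  | zero x => exact absurd rfl hc0
  | neg hx =>
    obtain ⟨i, hi⟩ := hpos
    have := hx.nonneg i
    simp at hi this
    omega

lemma Generates.isRoot_nonneg (hD : D.Generates) {c : ι → ℤ} (hc : D.IsRoot c)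
    (hpos : ∃ i, 0 < c i) : 0 ≤ c := by
  obtain ⟨x, hx, -⟩ := hD.exists_word hc hpos
  exact hx.nonneg

lemma Word.isRoot {c : ι → ℤ} {x : L} (hx : D.Word K J c x) (hx0 : x ≠ 0) : D.IsRoot c :=
  ⟨hx.ne_zero, x, hx.mem_weightSpace, hx0⟩

variable (D J) in
/-- The coordinates of the roots in which the letters outside `J` occur once. -/
def IsOuterRoot (c : ι → ℤ) : Prop := D.IsRoot c ∧ 0 ≤ c ∧ outerHeight J c = 1

lemma Word.isOuterRoot {c : ι → ℤ} {x : L} (hx : D.Word Jᶜ J c x) (hx0 : x ≠ 0) :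
    D.IsOuterRoot J c := ⟨hx.isRoot hx0, hx.nonneg, hx.outerHeight_eq_one⟩

/-- A root with one letter outside `J` is simple, or remains a root after subtracting a suitable
`α_j` with `j ∈ J`. -/
lemma Generates.isOuterRoot_cases (hD : D.Generates) {c : ι → ℤ} (hc : D.IsOuterRoot J c) :
    (∃ i ∉ J, c = Pi.single i 1) ∨ ∃ j ∈ J, D.IsOuterRoot J (c - Pi.single j 1) := by
  obtain ⟨h1, h2, h3⟩ := hc
  obtain ⟨i, -, hi⟩ := exists_pos_of_outerHeight (J := J) (c := c) (by omega)
  obtain ⟨x, hx, hx0⟩ := hD.exists_word h1 ⟨i, hi⟩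
  obtain ⟨y, hy, hy0⟩ := hx.exists_wordProd hx0 h3.ge
  -- Every factor of a product contributes 1 to the outer height, so there is only one factor. Its
  -- outermost letter, if the word is longer than one letter, is the required `j`.
  have hw := hy.word_of_outerHeight_eq_one h3
  cases hw with
  | base i hi' => exact .inl ⟨i, hi', rfl⟩
  | @step j hj d z hz =>
    refine .inr ⟨j, hj, ?_⟩
    rw [add_sub_cancel_right]
    exact hz.isOuterRoot fun h => hy0 (by rw [h, lie_zero])

lemma WordProd.exists_multiset {c : ι → ℤ} {x : L} (hx : D.WordProd J c x) (hx0 : x ≠ 0) :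
    ∃ S : Multiset (ι → ℤ), (∀ d ∈ S, D.IsOuterRoot J d) ∧ c = S.sum := by
  induction hx with
  | base hx => exact ⟨{_}, by simpa using hx.isOuterRoot hx0, by simp⟩
  | step hx hy ih =>
    obtain ⟨S, hS, rfl⟩ := ih fun h => hx0 (by rw [h, lie_zero])
    refine ⟨_ ::ₘ S, ?_, (Multiset.sum_cons _ _).symm⟩
    intro d hd
    rcases Multiset.mem_cons.1 hd with rfl | hd
    · exact hx.isOuterRoot fun h => hx0 (by rw [h, zero_lie])
    · exact hS d hd

/-- A root involving letters outside `J` is a sum of roots in which such letters occur once. -/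
lemma Generates.exists_multiset (hD : D.Generates) {c : ι → ℤ} (hc : D.IsRoot c)
    (h : 1 ≤ outerHeight J c) :
    ∃ S : Multiset (ι → ℤ), (∀ d ∈ S, D.IsOuterRoot J d) ∧ c = S.sum := by
  obtain ⟨i, -, hi⟩ := exists_pos_of_outerHeight (J := J) (c := c) (by omega)
  obtain ⟨x, hx, hx0⟩ := hD.exists_word hc ⟨i, hi⟩
  obtain ⟨y, hy, hy0⟩ := hx.exists_wordProd hx0 h
  exact hy.exists_multiset hy0

/-- The Serre relations imply that `ad e_j` is locally nilpotent. -/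
lemma Generates.exists_opE_pow_eq_zero (hD : D.Generates) (hS : D.SerreE) (j : ι) (y : L) :
    ∃ N : ℕ, (D.opE L j ^ N) y = 0 := by
  -- The elements on which `ad e_j` is nilpotent form a subalgebra, so the generators suffice. The
  -- exponents 3 and 2 below come from the chain `f_j ↦ α_j^∨ ↦ e_j ↦ 0`, up to scalars.
  have key : y ∈ LieSubalgebra.engel ℂ (D.E j) := by
    refine hD.eq_top _ (fun i => ?_) (fun i => ?_) (fun x => ?_) y
    · by_cases hij : j = i
      · subst hij; exact LieSubalgebra.self_mem_engel _ _
      · exact (LieSubalgebra.mem_engel_iff _ _ _).2 ⟨_, hS j i hij⟩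
    · rw [LieSubalgebra.mem_engel_iff]
      by_cases hij : j = i
      · subst hij
        refine ⟨3, ?_⟩
        simp only [pow_succ, pow_zero, one_mul, Module.End.mul_apply, LieAlgebra.ad_apply]
        rw [D.lie_E_F_same, ← lie_skew _ (D.H _), D.lie_H_E]
        simp
      · exact ⟨1, by simp [D.lie_E_F_ne _ _ hij]⟩
    · rw [LieSubalgebra.mem_engel_iff]
      refine ⟨2, ?_⟩
      simp only [pow_succ, pow_zero, one_mul, Module.End.mul_apply, LieAlgebra.ad_apply]
      rw [← lie_skew _ (D.H _), D.lie_H_E]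
      simp
  exact (LieSubalgebra.mem_engel_iff _ _ _).1 key

/-- The set of roots in which letters outside `J` occur once is stable under the simple
reflections `s_j` with `j ∈ J`. -/
lemma Generates.isOuterRoot_reflection (hA : IsGeneralizedCartanMatrix A) (hD : D.Generates)
    (hS : D.SerreE) (hS' : D.swap.SerreE) {c : ι → ℤ} (hc : D.IsOuterRoot J c) {j : ι}
    (hj : j ∈ J) : D.IsOuterRoot J (c - Pi.single j (A.mulVec c j)) := by
  obtain ⟨⟨-, y, hy, hy0⟩, h2, h3⟩ := hc
  have h4 : outerHeight J (c - Pi.single j (A.mulVec c j)) = 1 := by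
    rw [map_sub, h3, outerHeight_single_of_mem hj, sub_zero]
  have h5 : D.IsRoot (c - Pi.single j (A.mulVec c j)) := by
    refine ⟨fun h => by rw [h, map_zero] at h4; omega, ?_⟩
    rw [map_sub, latticePoint_single]
    have hcj := latticePoint_coroot r c j
    rcases le_total 0 (A.mulVec c j) with h | h
    · obtain ⟨m, hm⟩ := Int.eq_ofNat_of_zero_le h
      rw [hm] at hcj ⊢
      rw [natCast_zsmul]
      -- The number of steps `m` equals the pairing with `α_j^∨`, the largest value that the string
      -- argument permits; it leads exactly to the reflected weight. Negative pairings are treated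
      -- with `e_j` and `f_j` interchanged.
      refine D.weightSpace_sub_ne_bot hA hy hy0 j (hD.exists_opE_pow_eq_zero hS j y) m ?_
      intro n hn h'
      rw [hcj] at h'
      have : (m : ℤ) = n := by exact_mod_cast h'
      omega
    · obtain ⟨m, hm⟩ := Int.eq_ofNat_of_zero_le (neg_nonneg.2 h)
      have hm' : A.mulVec c j = -m := by omega
      rw [hm'] at hcj ⊢
      rw [neg_smul, natCast_zsmul]
      have hy' : y ∈ D.swap.weightSpace L (-latticePoint r c) := by
        rwa [swap_weightSpace, neg_neg]
      obtain ⟨z, hz, hz0⟩ := D.swap.weightSpace_sub_ne_bot hA hy' hy0 j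
        (hD.swap.exists_opE_pow_eq_zero hS' j y) m (by
          intro n hn h'
          rw [LinearMap.neg_apply, hcj] at h'
          have : (m : ℤ) = n := by
            push_cast at h'
            rw [neg_neg] at h'
            exact_mod_cast h'
          omega)
      refine ⟨z, ?_, hz0⟩
      rw [swap_weightSpace] at hz
      rwa [show -(-latticePoint r c - m • r.root j) = latticePoint r c - -(m • r.root j) by abel]
        at hz
  -- Outer height 1 is preserved and forces a positive coefficient, so the reflected root is
  -- positive.
  obtain ⟨i, -, hi⟩ := exists_pos_of_outerHeight (J := J) (by omega :
    0 < outerHeight J (c - Pi.single j (A.mulVec c j)))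
  exact ⟨h5, hD.isRoot_nonneg h5 ⟨i, hi⟩, h4⟩

end ChevalleyData

end KacMoody

/-! ### The combinatorial induction on weights. -/

namespace KacMoody

section Combinatorics

variable {ι : Type*} [Fintype ι] [DecidableEq ι]

lemma mulVec_sub_single (A : Matrix ι ι ℤ) (a : ι → ℤ) (j : ι) (n : ℤ) (hj : A j j = 2) :
    A.mulVec (a - Pi.single j n) j = A.mulVec a j - 2 * n := by
  rw [Matrix.mulVec_sub, Pi.sub_apply, Matrix.mulVec_single]
  simp [hj]

/-- Weight combinatorics: `P` is the set of coordinate vectors `a` such that `λ - ∑ a_i α_i` is a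
weight. If it is closed under subtracting simple roots outside `J` from weights in
`λ - ℤ_{≥0} Π_J`, then it is also closed under subtracting elements of `R`. -/
lemma sub_sum_mem_of_sub_simple_mem {A : Matrix ι ι ℤ} (hA : ∀ i, A i i = 2) {J : Set ι}
    (l : ι → ℂ) (P R : (ι → ℤ) → Prop) (hP : ∀ a, P a → 0 ≤ a)
    (hup : ∀ a j, P a → ¬ P (a + Pi.single j 1) →
      ∃ n : ℕ, l j - (A.mulVec a j : ℤ) = -(n : ℂ) ∧ P (a - Pi.single j (n : ℤ)))
    (hdown : ∀ a j (m : ℕ), P a → (∀ n : ℤ, n < m → l j - (A.mulVec a j : ℤ) ≠ (n : ℂ)) →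
      P (a + Pi.single j (m : ℤ)))
    (hR0 : ∀ c, R c → 0 ≤ c)
    (hRs : ∀ c, R c → ∀ j ∈ J, R (c - Pi.single j (A.mulVec c j)))
    (hRc : ∀ c, R c → (∃ i ∉ J, c = Pi.single i 1) ∨ ∃ j ∈ J, R (c - Pi.single j 1))
    (hsimple : ∀ a b, P a → (∀ i ∉ J, a i = 0) → 0 ≤ b → (∀ i ∈ J, b i = 0) → P (a + b))
    (a : ι → ℤ) (ha : P a) (haJ : ∀ i ∉ J, a i = 0) (S : Multiset (ι → ℤ))
    (hS : ∀ c ∈ S, R c) : P (a + S.sum) := by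
  have hht0 : ∀ c : ι → ℤ, 0 ≤ c → 0 ≤ ∑ i, c i := fun c hc => Finset.sum_nonneg fun i _ => hc i
  have hsum0 : ∀ S : Multiset (ι → ℤ), (∀ c ∈ S, R c) → 0 ≤ S.sum := fun S hS =>
    Multiset.sum_nonneg fun c hc => hR0 c (hS c hc)
  -- Lexicographic induction on the total depth `N` and then on `M`, the part of it carried by `S`.
  -- Transferring `α_j` from `S` to `a` lowers `M` alone; reflecting lowers `N`, and then `M` may be
  -- anything.
  have hmain : ∀ N M : ℕ, ∀ a : ι → ℤ, P a → (∀ i ∉ J, a i = 0) → ∀ S : Multiset (ι → ℤ),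
      (∀ c ∈ S, R c) → ∑ i, (a + S.sum) i = N → ∑ i, S.sum i = M → P (a + S.sum) := by
    intro N
    induction N using Nat.strong_induction_on with
    | _ N ihN =>
    intro M
    induction M using Nat.strong_induction_on with
    | _ M ihM =>
    intro a ha haJ S hS hN hM
    by_cases hcase : ∀ c ∈ S, ∃ i ∉ J, c = Pi.single i 1
    · refine hsimple a _ ha haJ (hsum0 S hS) fun i hi => ?_
      change Pi.evalAddMonoidHom (fun _ : ι => ℤ) i S.sum = 0
      rw [map_multiset_sum]
      refine Multiset.sum_eq_zero fun x hx => ?_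
      obtain ⟨c, hc, rfl⟩ := Multiset.mem_map.1 hx
      obtain ⟨k, hk, rfl⟩ := hcase c hc
      exact Pi.single_eq_of_ne (by rintro rfl; exact hk hi) _
    push Not at hcase
    obtain ⟨c, hcS, hc⟩ := hcase
    obtain ⟨T, rfl⟩ := Multiset.exists_cons_of_mem hcS
    have hRcc := hS c hcS
    have hRT : ∀ d ∈ T, R d := fun d hd => hS d (Multiset.mem_cons_of_mem hd)
    rcases hRc c hRcc with ⟨i, hi, h⟩ | ⟨j, hj, hcj⟩
    · exact absurd h (hc i hi)
    have hS' : ∀ d ∈ (c - Pi.single j 1) ::ₘ T, R d := by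
      intro d hd
      rcases Multiset.mem_cons.1 hd with rfl | hd
      exacts [hcj, hRT d hd]
    have hs1 : ∀ n : ℤ, ∑ i, (Pi.single j n : ι → ℤ) i = n := fun n => by simp
    rw [Multiset.sum_cons] at hN hM ⊢
    by_cases hpa : P (a + Pi.single j 1)
    · have h1 := hht0 _ (hsum0 _ hS')
      have h2 : ∑ i, ((c - Pi.single j 1) ::ₘ T).sum i = M - 1 := by
        rw [← hM, Multiset.sum_cons]
        simp only [Pi.add_apply, Pi.sub_apply, Finset.sum_add_distrib, Finset.sum_sub_distrib, hs1]
        ring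
      have h3 : a + Pi.single j 1 + ((c - Pi.single j 1) ::ₘ T).sum = a + (c + T.sum) := by
        rw [Multiset.sum_cons]; abel
      rw [h2] at h1
      rw [← h3]
      refine ihM (M - 1) (by omega) _ hpa ?_ _ hS' (by rw [h3, hN]) (by rw [h2]; omega)
      intro i hi
      rw [Pi.add_apply, haJ i hi, zero_add]
      exact Pi.single_eq_of_ne (by rintro rfl; exact hi hj) _
    · obtain ⟨n, hn, hPn⟩ := hup a j ha hpa
      -- Here `λ - a` pairs with `α_j^∨` to `-n`, and `a - n α_j` is its reflection. The target is
      -- `b`; its neighbour `b - α_j` is covered by induction on `N`.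
      set b : ι → ℤ := a + (c + T.sum) with hb
      have hb1 : b - Pi.single j 1 = a + ((c - Pi.single j 1) ::ₘ T).sum := by
        rw [Multiset.sum_cons, hb]; abel
      have hbht : ∀ n : ℤ, ∑ i, (b - Pi.single j n : ι → ℤ) i = N - n := by
        intro n
        simp only [Pi.sub_apply, Finset.sum_sub_distrib, hs1]
        rw [hN]
      have hPb1 : P (b - Pi.single j 1) := by
        have h := hbht 1
        have h0 := hht0 _ (add_nonneg (hP a ha) (hsum0 _ hS'))
        have h4 := hht0 _ (hsum0 _ hS')
        rw [hb1] at h ⊢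
        rw [h] at h0
        exact ihN (N - 1) (by omega) (∑ i, ((c - Pi.single j 1) ::ₘ T).sum i).toNat _ ha haJ _ hS'
          (by rw [h]; omega) (by omega)
      by_contra hcon
      -- If the single step from `b - α_j` to `b` fails, `λ - b + α_j` pairs with `α_j^∨` to an
      -- integer `k ≤ 0`. Hence `λ - b` pairs to `-p` with `p = 2 - k ≥ 2`.
      obtain ⟨k, hk1, hk2⟩ : ∃ k : ℤ, k < (1 : ℕ) ∧
          l j - (A.mulVec (b - Pi.single j 1) j : ℤ) = (k : ℂ) := by
        by_contra! hcon'
        refine hcon ?_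
        have := hdown _ j 1 hPb1 hcon'
        rwa [Nat.cast_one, sub_add_cancel] at this
      rw [mulVec_sub_single A b j 1 (hA j)] at hk2
      obtain ⟨p, hp⟩ := Int.eq_ofNat_of_zero_le (show 0 ≤ 2 - k by omega)
      have hlb : l j - (A.mulVec b j : ℤ) = -(p : ℂ) := by
        have : (p : ℂ) = 2 - k := by exact_mod_cast hp.symm
        rw [this]
        push_cast at hk2 ⊢
        linear_combination hk2
      set S' : Multiset (ι → ℤ) := (c ::ₘ T).map fun d => d - Pi.single j (A.mulVec d j) with hS'd
      have hRS' : ∀ d ∈ S', R d := by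
        intro d hd
        obtain ⟨d', hd', rfl⟩ := Multiset.mem_map.1 hd
        exact hRs d' (hS d' hd') j hj
      let refl : (ι → ℤ) →+ (ι → ℤ) :=
        { toFun := fun d => d - Pi.single j (A.mulVec d j)
          map_zero' := by simp
          map_add' := fun x y => by
            rw [Matrix.mulVec_add, Pi.add_apply, Pi.single_add]; abel }
      have hsumS' : S'.sum = (c + T.sum) - Pi.single j (A.mulVec (c + T.sum) j) := by
        have := map_multiset_sum refl (c ::ₘ T)
        rw [Multiset.sum_cons] at this
        exact this.symm
      have hpn : (p : ℤ) = n + A.mulVec (c + T.sum) j := by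
        rw [hb, Matrix.mulVec_add, Pi.add_apply] at hlb
        push_cast at hlb
        have : (p : ℂ) = n + (A.mulVec (c + T.sum) j : ℤ) := by
          linear_combination hlb - hn
        exact_mod_cast this
      -- The reflection of `b` is the sum of the reflections of `a` and of the members of `S`. Its
      -- depth is `N - p < N`, so induction applies to it.
      have hrefl : b - Pi.single j (p : ℤ) = (a - Pi.single j (n : ℤ)) + S'.sum := by
        rw [hsumS', hpn, Pi.single_add, hb]; abel
      have hPr : P (b - Pi.single j (p : ℤ)) := by
        have h := hbht p
        have h0 := hht0 _ (add_nonneg (hP _ hPn) (hsum0 _ hRS'))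
        have h4 := hht0 _ (hsum0 _ hRS')
        rw [hrefl] at h ⊢
        rw [h] at h0
        refine ihN (N - p) (by omega) (∑ i, S'.sum i).toNat _ hPn ?_ _ hRS' (by rw [h]; omega)
          (by omega)
        intro i hi
        rw [Pi.sub_apply, haJ i hi, zero_sub, neg_eq_zero]
        exact Pi.single_eq_of_ne (by rintro rfl; exact hi hj) _
      refine hcon ?_
      -- The reflected weight pairs with `α_j^∨` to exactly `p`, so `p` steps down are allowed and
      -- lead back to `b`, contradicting the assumption.
      have := hdown _ j p hPr fun k hk h => ?_
      · rwa [sub_add_cancel] at this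
      · rw [mulVec_sub_single A b j p (hA j)] at h
        have : (p : ℂ) = k := by
          push_cast at h
          linear_combination h - hlb
        have : (p : ℤ) = k := by exact_mod_cast this
        omega
  have h1 := hht0 _ (add_nonneg (hP a ha) (hsum0 S hS))
  have h2 := hht0 _ (hsum0 S hS)
  exact hmain (∑ i, (a + S.sum) i).toNat (∑ i, S.sum i).toNat a ha haJ S hS (by omega) (by omega)

end Combinatorics

/-! ### Highest weight modules. -/

namespace ChevalleyData

variable {ι : Type*} [Fintype ι] [DecidableEq ι] {A : Matrix ι ι ℤ}
variable {𝔥 : Type*} [AddCommGroup 𝔥] [Module ℂ 𝔥] {r : Realization A 𝔥}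
variable {L : Type*} [LieRing L] [LieAlgebra ℂ L] (D : ChevalleyData r L)
variable {M : Type*} [AddCommGroup M] [LieRingModule L M]

/-- Vectors `f_{j_1} ⋯ f_{j_n} v` with all `j_k ∈ J`, with the coordinates of their depth. -/
inductive VecWord (v : M) (J : Set ι) : (ι → ℤ) → M → Prop
  | nil : VecWord v J 0 v
  | step (j : ι) (hj : j ∈ J) {c : ι → ℤ} {m : M} (hm : VecWord v J c m) :
      VecWord v J (c + Pi.single j 1) ⁅D.F j, m⁆

variable {D} {v : M} {J : Set ι}

lemma VecWord.nonneg {c : ι → ℤ} {m : M} (h : D.VecWord v J c m) : 0 ≤ c := by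
  induction h with
  | nil => exact le_rfl
  | step j hj hx ih => exact add_nonneg ih (Pi.single_nonneg.2 zero_le_one)

lemma VecWord.apply_eq_zero {c : ι → ℤ} {m : M} (h : D.VecWord v J c m) {i : ι} (hi : i ∉ J) :
    c i = 0 := by
  induction h with
  | nil => rfl
  | step j hj hx ih =>
    rw [Pi.add_apply, ih, zero_add]; exact Pi.single_eq_of_ne (by rintro rfl; exact hi hj) _

lemma VecWord.mem_of_apply_ne_zero {K : Set ι} {c : ι → ℤ} {m : M} (h : D.VecWord v J c m)
    (hc : ∀ i ∉ K, c i = 0) : D.VecWord v K c m := by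
  induction h with
  | nil => exact .nil
  | @step j hj c m hm ih =>
    have hjK : j ∈ K := by
      by_contra hjK
      have h1 := hc j hjK
      have h2 := hm.nonneg j
      simp at h1 h2
      omega
    refine .step j hjK (ih fun i hi => ?_)
    have h1 := hc i hi
    rwa [Pi.add_apply, Pi.single_eq_of_ne (by rintro rfl; exact hi hjK), add_zero] at h1

variable (D) in
/-- Vectors `x_1 ⋯ x_k m` with `m` a word in the `f_j v`, `j ∈ J`, and each `x_i` an iterated
bracket of `f`s with exactly one letter outside `J`. -/
inductive VecProd (v : M) (J : Set ι) : (ι → ℤ) → M → Prop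
  | base {c : ι → ℤ} {m : M} (hm : D.VecWord v J c m) : VecProd v J c m
  | step {c d : ι → ℤ} {y : L} {m : M} (hy : D.swap.Word Jᶜ J c y) (hm : VecProd v J d m) :
      VecProd v J (c + d) ⁅y, m⁆

variable [Module ℂ M] [LieModule ℂ L M]

variable (D) in
/-- The vector `v` is a highest weight vector of weight `lam` generating the module. -/
structure IsHighestWeightVector (lam : Module.Dual ℂ 𝔥) (v : M) : Prop where
  ne_zero : v ≠ 0
  lie_E : ∀ i, ⁅D.E i, v⁆ = 0
  mem_weightSpace : v ∈ D.weightSpace M lam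
  lieSpan_eq_top : LieSubmodule.lieSpan ℂ L {v} = ⊤

variable {lam : Module.Dual ℂ 𝔥}

lemma VecWord.mem_weightSpace (hv : v ∈ D.weightSpace M lam) {c : ι → ℤ} {m : M}
    (h : D.VecWord v J c m) : m ∈ D.weightSpace M (lam - latticePoint r c) := by
  induction h with
  | nil => simpa using hv
  | step j hj hm ih =>
    rw [map_add, latticePoint_single, one_smul, ← sub_sub]
    exact D.lie_F_mem ih j

lemma VecProd.mem_weightSpace (hv : v ∈ D.weightSpace M lam) {c : ι → ℤ} {m : M}
    (h : D.VecProd v J c m) : m ∈ D.weightSpace M (lam - latticePoint r c) := by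
  induction h with
  | base hm => exact hm.mem_weightSpace hv
  | @step c d y m hy hm ih =>
    have h1 := hy.mem_weightSpace
    rw [swap_weightSpace] at h1
    have := D.lie_mem_weightSpace h1 ih
    rwa [show -latticePoint r c + (lam - latticePoint r d) = lam - latticePoint r (c + d) by
      rw [map_add]; abel] at this

lemma VecWord.lie_E_mem (hv : v ∈ D.weightSpace M lam) (hE : ∀ i, ⁅D.E i, v⁆ = 0)
    {c : ι → ℤ} {m : M} (h : D.VecWord v J c m) (i : ι) :
    ⁅D.E i, m⁆ ∈ Submodule.span ℂ {m | ∃ c, D.VecWord v J c m} := by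
  induction h with
  | nil => rw [hE]; exact zero_mem _
  | step j hj hm ih =>
    rw [leibniz_lie]
    refine add_mem ?_ ?_
    · by_cases hij : i = j
      · subst hij
        rw [D.lie_E_F_same, hm.mem_weightSpace hv]
        exact Submodule.smul_mem _ _ (mem_span_of_exists hm)
      · rw [D.lie_E_F_ne _ _ hij, zero_lie]; exact zero_mem _
    · refine lie_mem_of_span _ ?_ ih
      rintro m ⟨c, hc⟩
      exact mem_span_of_exists (.step j hj hc)

lemma IsHighestWeightVector.span_vecWord (hD : D.Generates)
    (hv : D.IsHighestWeightVector lam v) (y : M) :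
    y ∈ Submodule.span ℂ {m | ∃ c, D.VecWord v Set.univ c m} := by
  let N : LieSubmodule ℂ L M :=
    { Submodule.span ℂ {m | ∃ c, D.VecWord v Set.univ c m} with
      lie_mem := fun {x m} hm => by
        refine hD.lie_mem (fun i m hm => ?_) (fun i m hm => ?_) (fun x m hm => ?_) x hm
        · refine lie_mem_of_span _ ?_ hm
          rintro m ⟨c, hc⟩
          exact hc.lie_E_mem hv.mem_weightSpace hv.lie_E i
        · refine lie_mem_of_span _ ?_ hm
          rintro m ⟨c, hc⟩
          exact mem_span_of_exists (.step i (Set.mem_univ i) hc)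
        · refine lie_mem_of_span _ ?_ hm
          rintro m ⟨c, hc⟩
          rw [hc.mem_weightSpace hv.mem_weightSpace]
          exact Submodule.smul_mem _ _ (mem_span_of_exists hc) }
  have : (⊤ : LieSubmodule ℂ L M) ≤ N := by
    rw [← hv.lieSpan_eq_top, LieSubmodule.lieSpan_le, Set.singleton_subset_iff]
    exact mem_span_of_exists .nil
  exact this trivial

/-- A letter in `J` is moved to the right past the brackets: its commutator with a bracket is again
a bracket with one letter outside `J`. A letter outside `J` is itself such a bracket. -/
lemma VecProd.lie_F_mem {c : ι → ℤ} {m : M} (h : D.VecProd v J c m) (i : ι) :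
    ⁅D.F i, m⁆ ∈ Submodule.span ℂ {m | ∃ c, D.VecProd v J c m} := by
  by_cases hi : i ∈ J
  · induction h with
    | base hm => exact mem_span_of_exists (.base (.step i hi hm))
    | step hy hm ih =>
      rw [leibniz_lie]
      refine add_mem (mem_span_of_exists (.step (.step i hi hy) hm)) ?_
      refine lie_mem_of_span _ ?_ ih
      rintro m ⟨c, hc⟩
      exact mem_span_of_exists (.step hy hc)
  · exact mem_span_of_exists (.step (.base (D := D.swap) i hi) h)

lemma IsHighestWeightVector.span_vecProd (hD : D.Generates)
    (hv : D.IsHighestWeightVector lam v) (J : Set ι) (y : M) :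
    y ∈ Submodule.span ℂ {m | ∃ c, D.VecProd v J c m} := by
  have : Submodule.span ℂ {m | ∃ c, D.VecWord v Set.univ c m} ≤
      Submodule.span ℂ {m | ∃ c, D.VecProd v J c m} := by
    rw [Submodule.span_le]
    rintro m ⟨c, hc⟩
    induction hc with
    | nil => exact mem_span_of_exists (.base .nil)
    | step j hj hm ih =>
      refine lie_mem_of_span _ ?_ ih
      rintro m ⟨c, hc⟩
      exact hc.lie_F_mem j
  exact this (hv.span_vecWord hD y)

/-- The depths of the weights: `λ - ∑ a_i α_i` is a weight of the module. -/
def IsDepth (D : ChevalleyData r L) (M : Type*) [AddCommGroup M] [Module ℂ M] [LieRingModule L M]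
    [LieModule ℂ L M] (lam : Module.Dual ℂ 𝔥) (a : ι → ℤ) : Prop :=
  ∃ y ∈ D.weightSpace M (lam - latticePoint r a), y ≠ 0

lemma VecWord.isDepth (hv : v ∈ D.weightSpace M lam) {c : ι → ℤ} {m : M}
    (h : D.VecWord v J c m) (hm : m ≠ 0) : D.IsDepth M lam c := ⟨m, h.mem_weightSpace hv, hm⟩

lemma IsHighestWeightVector.exists_vecWord (hD : D.Generates)
    (hv : D.IsHighestWeightVector lam v) {μ : Module.Dual ℂ 𝔥} {y : M}
    (hy : y ∈ D.weightSpace M μ) (hy0 : y ≠ 0) :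
    ∃ a m, μ = lam - latticePoint r a ∧ D.VecWord v Set.univ a m ∧ m ≠ 0 := by
  obtain ⟨m, ⟨c, rfl, hc⟩, hm⟩ := D.exists_of_mem_span
    (fun μ m => ∃ c, μ = lam - latticePoint r c ∧ D.VecWord v Set.univ c m)
    (by rintro μ m ⟨c, rfl, hc⟩; exact hc.mem_weightSpace hv.mem_weightSpace) hy hy0 (by
      refine Submodule.span_mono ?_ (hv.span_vecWord hD y)
      rintro m ⟨c, hc⟩
      exact ⟨_, c, rfl, hc⟩)
  exact ⟨c, m, rfl, hc, hm⟩

lemma IsHighestWeightVector.exists_vecWord_of_isDepth (hD : D.Generates)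
    (hv : D.IsHighestWeightVector lam v) {a : ι → ℤ} (ha : D.IsDepth M lam a) :
    ∃ m, D.VecWord v Set.univ a m ∧ m ≠ 0 := by
  obtain ⟨y, hy, hy0⟩ := ha
  obtain ⟨c, m, h, hc, hm⟩ := hv.exists_vecWord hD hy hy0
  obtain rfl := latticePoint_injective r (sub_right_injective h)
  exact ⟨m, hc, hm⟩

lemma IsHighestWeightVector.isDepth_nonneg (hD : D.Generates)
    (hv : D.IsHighestWeightVector lam v) {a : ι → ℤ} (ha : D.IsDepth M lam a) : 0 ≤ a := by
  obtain ⟨m, hm, -⟩ := hv.exists_vecWord_of_isDepth hD ha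
  exact hm.nonneg

lemma VecProd.exists_multiset (hv : v ∈ D.weightSpace M lam) {c : ι → ℤ} {m : M}
    (h : D.VecProd v J c m) (hm0 : m ≠ 0) :
    ∃ a, D.IsDepth M lam a ∧ (∀ i ∉ J, a i = 0) ∧ ∃ S : Multiset (ι → ℤ),
      (∀ d ∈ S, D.swap.IsOuterRoot J d) ∧ c = a + S.sum := by
  induction h with
  | @base c m hm => exact ⟨c, hm.isDepth hv hm0, fun i hi => hm.apply_eq_zero hi, 0, by simp⟩
  | @step c d y m hy hm ih =>
    obtain ⟨a, ha, haJ, S, hS, rfl⟩ := ih fun h => hm0 (by rw [h, lie_zero])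
    refine ⟨a, ha, haJ, c ::ₘ S, ?_, by rw [Multiset.sum_cons]; abel⟩
    intro d hd
    rcases Multiset.mem_cons.1 hd with rfl | hd
    · exact hy.isOuterRoot fun h => hm0 (by rw [h, zero_lie])
    · exact hS d hd

/-- Every weight is obtained from a weight in `λ - ℤ_{≥0} Π_J` by subtracting roots in which
letters outside `J` occur once. -/
lemma IsHighestWeightVector.exists_multiset (hD : D.Generates)
    (hv : D.IsHighestWeightVector lam v) (J : Set ι) {c : ι → ℤ} (hc : D.IsDepth M lam c) :
    ∃ a, D.IsDepth M lam a ∧ (∀ i ∉ J, a i = 0) ∧ ∃ S : Multiset (ι → ℤ),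
      (∀ d ∈ S, D.swap.IsOuterRoot J d) ∧ c = a + S.sum := by
  obtain ⟨y, hy, hy0⟩ := hc
  obtain ⟨m, ⟨d, hd, hdm⟩, hm⟩ := D.exists_of_mem_span
    (fun μ m => ∃ c, μ = lam - latticePoint r c ∧ D.VecProd v J c m)
    (by rintro μ m ⟨c, rfl, hc⟩; exact hc.mem_weightSpace hv.mem_weightSpace) hy hy0 (by
      refine Submodule.span_mono ?_ (hv.span_vecProd hD J y)
      rintro m ⟨c, hc⟩
      exact ⟨_, c, rfl, hc⟩)
  obtain rfl := latticePoint_injective r (sub_right_injective hd)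
  exact hdm.exists_multiset hv.mem_weightSpace hm

/-- The `e_i` act nilpotently on weight vectors. -/
lemma IsHighestWeightVector.exists_opE_pow_eq_zero (hD : D.Generates)
    (hv : D.IsHighestWeightVector lam v) {a : ι → ℤ} {y : M}
    (hy : y ∈ D.weightSpace M (lam - latticePoint r a)) (i : ι) :
    ∃ N : ℕ, (D.opE M i ^ N) y = 0 := by
  -- One power more than `a i` would make the `i`-th coordinate of the depth negative.
  refine ⟨(a i).toNat + 1, ?_⟩
  by_contra hcon
  have h := D.opE_pow_mem hy i ((a i).toNat + 1)
  have h' : D.IsDepth M lam (a - Pi.single i (((a i).toNat + 1 : ℕ) : ℤ)) := by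
    refine ⟨_, ?_, hcon⟩
    rwa [map_sub, latticePoint_single, natCast_zsmul, ← sub_add]
  have := hv.isDepth_nonneg hD h' i
  simp at this

lemma IsHighestWeightVector.isDepth_add (hA : IsGeneralizedCartanMatrix A) (hD : D.Generates)
    (hv : D.IsHighestWeightVector lam v) {a : ι → ℤ} (ha : D.IsDepth M lam a) (j : ι) (m : ℕ)
    (h : ∀ n : ℤ, n < m → lam (r.coroot j) - (A.mulVec a j : ℤ) ≠ (n : ℂ)) :
    D.IsDepth M lam (a + Pi.single j (m : ℤ)) := by
  obtain ⟨y, hy, hy0⟩ := ha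
  obtain ⟨z, hz, hz0⟩ := D.weightSpace_sub_ne_bot hA hy hy0 j (hv.exists_opE_pow_eq_zero hD hy j) m
    (by rwa [LinearMap.sub_apply, latticePoint_coroot])
  refine ⟨z, ?_, hz0⟩
  rwa [map_add, latticePoint_single, natCast_zsmul, ← sub_sub]

lemma IsHighestWeightVector.exists_of_not_isDepth (hA : IsGeneralizedCartanMatrix A)
    (hD : D.Generates) (hv : D.IsHighestWeightVector lam v) {a : ι → ℤ}
    (ha : D.IsDepth M lam a) (j : ι) (h : ¬ D.IsDepth M lam (a + Pi.single j 1)) :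
    ∃ n : ℕ, lam (r.coroot j) - (A.mulVec a j : ℤ) = -(n : ℂ) ∧
      D.IsDepth M lam (a - Pi.single j (n : ℤ)) := by
  obtain ⟨y, hy, hy0⟩ := ha
  have hF : ⁅D.F j, y⁆ = 0 := by
    by_contra hcon
    refine h ⟨_, ?_, hcon⟩
    rw [map_add, latticePoint_single, one_smul, ← sub_sub]
    exact D.lie_F_mem hy j
  obtain ⟨n, hn, z, hz, hz0⟩ := D.exists_of_lie_F_eq_zero hA hy hy0 j
    (hv.exists_opE_pow_eq_zero hD hy j) hF
  rw [LinearMap.sub_apply, latticePoint_coroot] at hn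
  refine ⟨n, hn, z, ?_, hz0⟩
  rwa [map_sub, latticePoint_single, natCast_zsmul, ← sub_add]

lemma VecWord.ofPow {i : ι} {K : Set ι} {m : M} {c : ι → ℤ} (n : ℕ)
    (h : D.VecWord ((D.opF M i ^ n) v) K c m) :
    D.VecWord v (insert i K) (c + Pi.single i (n : ℤ)) m := by
  induction h with
  | nil =>
    rw [zero_add]
    induction n with
    | zero => simpa using VecWord.nil
    | succ n ih =>
      rw [pow_succ', Module.End.mul_apply]
      have := VecWord.step i (Set.mem_insert i K) ih
      rwa [← Pi.single_add] at this
  | step j hj hm ih =>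
    rw [add_right_comm]
    exact .step j (Set.mem_insert_of_mem _ hj) ih

/-- Replacing the vector `v` at the end of an `f`-word by a multiple of `e_i^n v'`, where `e_i`
commutes with all letters. -/
lemma VecWord.exists_pow {i : ι} (hi : i ∉ J) {n : ℕ} {v' : M} {t : ℂ}
    (hv' : (D.opE M i ^ n) v' = t • v) {c : ι → ℤ} {m : M} (h : D.VecWord v J c m) :
    ∃ m', D.VecWord v' J c m' ∧ (D.opE M i ^ n) m' = t • m := by
  induction h with
  | nil => exact ⟨v', .nil, hv'⟩
  | @step j hj c m hm ih =>
    obtain ⟨m', hm', h⟩ := ih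
    refine ⟨_, .step j hj hm', ?_⟩
    have hcomm : Commute (D.opE M i) (D.opF M j) := by
      ext x
      have := leibniz_lie (D.E i) (D.F j) x
      rwa [D.lie_E_F_ne i j (by rintro rfl; exact hi hj), zero_lie, zero_add] at this
    have := LinearMap.congr_fun (hcomm.pow_left n) m'
    rw [Module.End.mul_apply, Module.End.mul_apply, h, map_smul] at this
    exact this

/-- If `⟨λ, α_i^∨⟩ ∉ ℤ_{≥0}` and `μ` is a weight in `λ - ℤ_{≥0} Π_J` with `i ∉ J`, then `μ - n α_i`
is a weight. -/
lemma IsHighestWeightVector.isDepth_add_single (hA : IsGeneralizedCartanMatrix A)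
    (hD : D.Generates) (hv : D.IsHighestWeightVector lam v) {i : ι}
    (hlam : ∀ n : ℕ, lam (r.coroot i) ≠ (n : ℂ)) {a : ι → ℤ} (ha : D.IsDepth M lam a)
    (hi : a i = 0) (n : ℕ) : D.IsDepth M lam (a + Pi.single i (n : ℤ)) := by
  obtain ⟨m, hm, hm0⟩ := hv.exists_vecWord_of_isDepth hD ha
  have hm' := hm.mem_of_apply_ne_zero (K := {i}ᶜ) (by
    intro k hk
    rw [Set.mem_compl_iff, not_not, Set.mem_singleton_iff] at hk
    rwa [hk])
  -- The scalar `t` is the product of the factors `(k + 1) (λ(α_i^∨) - k)`, `k < n`, none of which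
  -- vanishes.
  have hpow : ∀ n : ℕ, ∃ t : ℂ, t ≠ 0 ∧ (D.opE M i ^ n) ((D.opF M i ^ n) v) = t • v := by
    intro n
    induction n with
    | zero => exact ⟨1, one_ne_zero, by simp⟩
    | succ n ih =>
      obtain ⟨t, ht, h⟩ := ih
      have h1 := D.lie_E_opF_pow hA hv.mem_weightSpace i (hv.lie_E i) n
      refine ⟨((n + 1 : ℂ) * (lam (r.coroot i) - n)) * t, mul_ne_zero (mul_ne_zero
        (Nat.cast_add_one_ne_zero n) (sub_ne_zero.2 (hlam n))) ht, ?_⟩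
      rw [pow_succ (D.opE M i), Module.End.mul_apply, LieModule.toEnd_apply_apply, h1, map_smul, h,
        smul_smul]
  obtain ⟨t, ht, h⟩ := hpow n
  -- The same word applied to `f_i^n v` is carried by `e_i^n` to `t • m ≠ 0`, hence is itself
  -- nonzero.
  obtain ⟨m', hm'', h'⟩ := hm'.exists_pow (by simp) h
  refine (hm''.ofPow n).isDepth hv.mem_weightSpace fun h0 => ?_
  rw [h0, map_zero, eq_comm, smul_eq_zero] at h'
  exact h'.elim ht hm0

lemma IsHighestWeightVector.isDepth_add_of_not_integral (hA : IsGeneralizedCartanMatrix A)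
    (hD : D.Generates) (hv : D.IsHighestWeightVector lam v) {J : Set ι}
    (hJ : ∀ i ∉ J, ∀ n : ℕ, lam (r.coroot i) ≠ (n : ℂ)) {a b : ι → ℤ} (ha : D.IsDepth M lam a)
    (haJ : ∀ i ∉ J, a i = 0) (hb : 0 ≤ b) (hbJ : ∀ i ∈ J, b i = 0) :
    D.IsDepth M lam (a + b) := by
  -- Coordinates are added one at a time, so that the `i`-th one is still zero when
  -- `isDepth_add_single` is applied.
  have key : ∀ s : Finset ι, D.IsDepth M lam (a + ∑ i ∈ s, Pi.single i (b i)) := by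
    intro s
    induction s using Finset.induction_on with
    | empty => simpa using ha
    | insert i s his ih =>
      rw [Finset.sum_insert his, add_left_comm, add_comm]
      by_cases hi : i ∈ J
      · rwa [hbJ i hi, Pi.single_zero, add_zero]
      · obtain ⟨n, hn⟩ := Int.eq_ofNat_of_zero_le (hb i)
        rw [hn]
        refine hv.isDepth_add_single hA hD (hJ i hi) ih ?_ n
        rw [Pi.add_apply, haJ i hi, zero_add, Finset.sum_apply]
        exact Finset.sum_eq_zero fun k hk => Pi.single_eq_of_ne (by rintro rfl; exact his hk) _
  have := key Finset.univ
  rwa [Finset.univ_sum_single] at this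

/-- If `wt_J - ℤ_{≥0} Π_{J^c}` consists of weights, then so does `wt_J - ℤ_{≥0} Δ_{J^c,1}`. -/
lemma IsHighestWeightVector.isDepth_add_sum (hA : IsGeneralizedCartanMatrix A)
    (hD : D.Generates) (hS : D.SerreE) (hS' : D.swap.SerreE)
    (hv : D.IsHighestWeightVector lam v) {J : Set ι}
    (hJ : ∀ a b, D.IsDepth M lam a → (∀ i ∉ J, a i = 0) → 0 ≤ b → (∀ i ∈ J, b i = 0) →
      D.IsDepth M lam (a + b)) {a : ι → ℤ} (ha : D.IsDepth M lam a) (haJ : ∀ i ∉ J, a i = 0)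
    (S : Multiset (ι → ℤ)) (hRS : ∀ c ∈ S, D.IsOuterRoot J c) :
    D.IsDepth M lam (a + S.sum) :=
  sub_sum_mem_of_sub_simple_mem hA.diag (fun j => lam (r.coroot j)) (D.IsDepth M lam)
    (D.IsOuterRoot J) (fun _ h => hv.isDepth_nonneg hD h)
    (fun _ j ha h => hv.exists_of_not_isDepth hA hD ha j h)
    (fun _ j m ha h => hv.isDepth_add hA hD ha j m h) (fun _ hc => hc.2.1)
    (fun _ hc _ hj => hD.isOuterRoot_reflection hA hS hS' hc hj)
    (fun _ hc => hD.isOuterRoot_cases hc) hJ a ha haJ S hRS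

end ChevalleyData

end KacMoody

/-! ### Images of Chevalley generators, and the Serre elements. -/

namespace KacMoody

namespace ChevalleyData

variable {ι : Type*} [Fintype ι] {A : Matrix ι ι ℤ}
variable {𝔥 : Type*} [AddCommGroup 𝔥] [Module ℂ 𝔥] {r : Realization A 𝔥}
variable {L L' : Type*} [LieRing L] [LieAlgebra ℂ L] [LieRing L'] [LieAlgebra ℂ L']

/-- The image of Chevalley generators under a homomorphism. -/
@[simps]
def map (D : ChevalleyData r L) (φ : L →ₗ⁅ℂ⁆ L') : ChevalleyData r L' where
  E i := φ (D.E i)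
  F i := φ (D.F i)
  H := (φ : L →ₗ[ℂ] L').comp D.H
  lie_H_H x y := by simp [← LieHom.map_lie, D.lie_H_H]
  lie_E_F_same i := by simp [← LieHom.map_lie, D.lie_E_F_same]
  lie_E_F_ne i j hij := by simp [← LieHom.map_lie, D.lie_E_F_ne i j hij]
  lie_H_E x i := by simp [← LieHom.map_lie, D.lie_H_E]
  lie_H_F x i := by simp [← LieHom.map_lie, D.lie_H_F]

lemma _root_.KacMoody.map_ad_pow (φ : L →ₗ⁅ℂ⁆ L') (x y : L) (n : ℕ) :
    φ (((LieAlgebra.ad ℂ L x) ^ n) y) = ((LieAlgebra.ad ℂ L' (φ x)) ^ n) (φ y) := by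
  induction n with
  | zero => simp
  | succ n ih =>
    rw [pow_succ', pow_succ', Module.End.mul_apply, Module.End.mul_apply, LieAlgebra.ad_apply,
      LieAlgebra.ad_apply, LieHom.map_lie, ih]

variable {D : ChevalleyData r L}

lemma SerreE.map (h : D.SerreE) (φ : L →ₗ⁅ℂ⁆ L') : (D.map φ).SerreE := by
  intro i j hij
  rw [map_E, map_E, ← map_ad_pow, h i j hij, map_zero]

lemma Generates.map (h : D.Generates) (φ : L →ₗ⁅ℂ⁆ L') (hφ : Function.Surjective φ) :
    (D.map φ).Generates := by
  refine eq_top_iff.2 fun y _ => ?_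
  obtain ⟨x, rfl⟩ := hφ y
  refine h.eq_top ((LieSubalgebra.lieSpan ℂ L' _).comap φ) (fun i => ?_) (fun i => ?_)
    (fun z => ?_) x
  · exact LieSubalgebra.subset_lieSpan (.inl (.inl ⟨i, rfl⟩))
  · exact LieSubalgebra.subset_lieSpan (.inl (.inr ⟨i, rfl⟩))
  · exact LieSubalgebra.subset_lieSpan (.inr ⟨z, rfl⟩)

lemma Generates.hom_ext (h : D.Generates) {φ ψ : L →ₗ⁅ℂ⁆ L'} (hE : ∀ i, φ (D.E i) = ψ (D.E i))
    (hF : ∀ i, φ (D.F i) = ψ (D.F i)) (hH : ∀ x, φ (D.H x) = ψ (D.H x)) (y : L) : φ y = ψ y := by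
  let K : LieSubalgebra ℂ L :=
    { LinearMap.eqLocus (φ : L →ₗ[ℂ] L') (ψ : L →ₗ[ℂ] L') with
      lie_mem' := fun {a b} ha hb => by
        change φ a = ψ a at ha
        change φ b = ψ b at hb
        change φ ⁅a, b⁆ = ψ ⁅a, b⁆
        rw [LieHom.map_lie, LieHom.map_lie, ha, hb] }
  exact h.eq_top K hE hF hH y

/-- The Serre elements for the `f_i` commute with the `e_k`. -/
lemma lie_E_serre (hA : IsGeneralizedCartanMatrix A) (D : ChevalleyData r L) {i j : ι} (hij : i ≠ j)
    (k : ι) : ⁅D.E k, ((LieAlgebra.ad ℂ L (D.F i)) ^ (1 - A i j).toNat) (D.F j)⁆ = 0 := by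
  have hn : (1 - A i j).toNat = (-A i j).toNat + 1 := by
    have := hA.nonpos i j hij
    omega
  by_cases hk : k = i
  · subst hk
    have hw : D.F j ∈ D.weightSpace L (-r.root j) := by
      intro x; rw [D.lie_H_F, LinearMap.neg_apply, neg_smul]
    -- Under `ad`, `f_j` is a highest weight vector for the `k`-th `𝔰𝔩₂`, with pairing `-A k j`; the
    -- scalar vanishes at precisely the Serre exponent.
    have h := D.lie_E_opF_pow hA hw k (D.lie_E_F_ne k j hij) (-A k j).toNat
    rw [hn]
    refine h.trans ?_
    have h2 : (((-A k j).toNat : ℤ) : ℂ) = -(A k j : ℂ) := by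
      rw [Int.toNat_of_nonneg (by have := hA.nonpos k j hij; omega)]; push_cast; rfl
    rw [Int.cast_natCast] at h2
    rw [LinearMap.neg_apply, r.root_coroot, h2, sub_self, mul_zero, zero_smul]
  · have hcomm : ∀ n : ℕ, ∀ y : L, ⁅D.E k, ((LieAlgebra.ad ℂ L (D.F i)) ^ n) y⁆ =
        ((LieAlgebra.ad ℂ L (D.F i)) ^ n) ⁅D.E k, y⁆ := by
      intro n y
      induction n with
      | zero => simp
      | succ n ih =>
        rw [pow_succ', Module.End.mul_apply, Module.End.mul_apply, LieAlgebra.ad_apply, leibniz_lie,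
          D.lie_E_F_ne k i hk, zero_lie, zero_add, ih, LieAlgebra.ad_apply]
    rw [hcomm]
    by_cases hkj : k = j
    · subst hkj
      rw [D.lie_E_F_same, hn, pow_succ, Module.End.mul_apply, LieAlgebra.ad_apply, ← lie_skew,
        D.lie_H_F, neg_neg, r.root_coroot, map_smul]
      -- One application of `ad f_i` turns `α_k^∨` into `A k i • f_i`. Either this coefficient
      -- vanishes by `zero_symm`, or the exponent leaves another `ad f_i`, which kills `f_i`.
      by_cases h0 : A i k = 0
      · rw [hA.zero_symm i k h0]; simp
      · obtain ⟨m, hm⟩ : ∃ m, (-A i k).toNat = m + 1 :=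
          Nat.exists_eq_succ_of_ne_zero (by have := hA.nonpos i k hij; omega)
        rw [hm, pow_succ, Module.End.mul_apply, LieAlgebra.ad_apply, lie_self, map_zero, smul_zero]
    · rw [D.lie_E_F_ne k j hkj, map_zero]

end ChevalleyData

/-! ### A Verma-type module on words, and its Serre submodule. -/

section VermaModule

attribute [local instance] LieRing.ofAssociativeRing

variable {ι : Type*}

/-- The action of `f_i` on the free module on words in the `f_i`. -/
noncomputable def wordF (i : ι) : Module.End ℂ (List ι →₀ ℂ) := Finsupp.lmapDomain ℂ ℂ (List.cons i)

lemma wordF_single (i : ι) (w : List ι) :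
    wordF i (Finsupp.single w (1 : ℂ)) = Finsupp.single (i :: w) 1 := by
  simp [wordF]

lemma end_ext_words {X Y : Module.End ℂ (List ι →₀ ℂ)}
    (h : ∀ w, X (Finsupp.single w 1) = Y (Finsupp.single w 1)) : X = Y := by
  ext w : 2
  simpa using h w

variable [Fintype ι] {A : Matrix ι ι ℤ}
variable {𝔥 : Type*} [AddCommGroup 𝔥] [Module ℂ 𝔥] (r : Realization A 𝔥)
variable (lam : Module.Dual ℂ 𝔥)

/-- The weight of the word `f_{i_1} ⋯ f_{i_n} v` for `v` of weight `lam`. -/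
def wordWeight : List ι → Module.Dual ℂ 𝔥
  | [] => lam
  | i :: w => wordWeight w - r.root i

/-- The action of `𝔥` on the free module on words in the `f_i`. -/
noncomputable def wordH : 𝔥 →ₗ[ℂ] Module.End ℂ (List ι →₀ ℂ) where
  toFun x := Finsupp.linearCombination ℂ fun w => wordWeight r lam w x • Finsupp.single w (1 : ℂ)
  map_add' x y := by
    ext w : 2
    simp [add_smul]
  map_smul' c x := by
    ext w : 2
    simp [mul_smul]

lemma wordH_single (x : 𝔥) (w : List ι) :
    wordH r lam x (Finsupp.single w 1) = wordWeight r lam w x • Finsupp.single w 1 := by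
  simp only [wordH, LinearMap.coe_mk, AddHom.coe_mk, Finsupp.linearCombination_single, one_smul]

lemma wordH_wordF (x : 𝔥) (i : ι) (t : List ι →₀ ℂ) :
    wordH r lam x (wordF i t) = wordF i (wordH r lam x t) - r.root i x • wordF i t := by
  have : wordH r lam x * wordF i = wordF i * wordH r lam x - r.root i x • wordF i := by
    refine end_ext_words fun w => ?_
    simp only [Module.End.mul_apply, LinearMap.sub_apply, LinearMap.smul_apply, wordF_single,
      wordH_single, map_smul, wordWeight, sub_smul]
  exact LinearMap.congr_fun this t

variable [DecidableEq ι]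

/-- The action of `e_i` on a word. -/
noncomputable def actE (i : ι) : List ι → (List ι →₀ ℂ)
  | [] => 0
  | j :: w => wordF j (actE i w) +
      if i = j then wordWeight r lam w (r.coroot i) • Finsupp.single w 1 else 0

/-- The action of `e_i` on the free module on words in the `f_i`. -/
noncomputable def wordE (i : ι) : Module.End ℂ (List ι →₀ ℂ) :=
  Finsupp.linearCombination ℂ (actE r lam i)

lemma wordE_single (i : ι) (w : List ι) :
    wordE r lam i (Finsupp.single w 1) = actE r lam i w := by
  simp [wordE]

lemma wordE_wordF (i j : ι) (t : List ι →₀ ℂ) : wordE r lam i (wordF j t) =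
    wordF j (wordE r lam i t) + if i = j then wordH r lam (r.coroot i) t else 0 := by
  have : wordE r lam i * wordF j =
      wordF j * wordE r lam i + if i = j then wordH r lam (r.coroot i) else 0 := by
    refine end_ext_words fun w => ?_
    split_ifs with h <;>
      simp [Module.End.mul_apply, wordF_single, wordE_single, wordH_single, actE, h]
  have h := LinearMap.congr_fun this t
  split_ifs at h ⊢ <;> exact h

lemma wordH_actE (x : 𝔥) (i : ι) (w : List ι) : wordH r lam x (actE r lam i w) =
    (wordWeight r lam w x + r.root i x) • actE r lam i w := by
  induction w with
  | nil => simp [actE]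
  | cons j w ih =>
    rw [actE, map_add, wordH_wordF, ih, smul_add, map_smul, ← sub_smul]
    congr 1
    · congr 1
      simp only [wordWeight, LinearMap.sub_apply]
      ring
    · split_ifs with h
      · subst h
        rw [map_smul, wordH_single, smul_comm]
        simp [wordWeight]
      · simp

/-- The Chevalley generators acting on the free module on words in the `f_i`. -/
noncomputable def wordData : ChevalleyData r (Module.End ℂ (List ι →₀ ℂ)) where
  E := wordE r lam
  F := wordF
  H := wordH r lam
  lie_H_H x y := by
    refine end_ext_words fun w => ?_
    rw [Ring.lie_def]
    simp only [LinearMap.sub_apply, Module.End.mul_apply, wordH_single, map_smul,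
      LinearMap.zero_apply]
    rw [smul_comm, sub_self]
  lie_E_F_same i := by
    refine LinearMap.ext fun t => ?_
    rw [Ring.lie_def]
    simp only [LinearMap.sub_apply, Module.End.mul_apply, wordE_wordF, if_true,
      add_sub_cancel_left]
  lie_E_F_ne i j hij := by
    refine LinearMap.ext fun t => ?_
    rw [Ring.lie_def]
    simp only [LinearMap.sub_apply, Module.End.mul_apply, wordE_wordF, if_neg hij,
      add_zero, sub_self, LinearMap.zero_apply]
  lie_H_E x i := by
    refine end_ext_words fun w => ?_
    rw [Ring.lie_def]
    simp only [LinearMap.sub_apply, Module.End.mul_apply, wordE_single, wordH_single, map_smul,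
      wordH_actE, LinearMap.smul_apply, add_smul, add_sub_cancel_left]
  lie_H_F x i := by
    refine LinearMap.ext fun t => ?_
    rw [Ring.lie_def]
    simp only [LinearMap.sub_apply, Module.End.mul_apply, wordH_wordF, LinearMap.neg_apply,
      LinearMap.smul_apply]
    abel

/-- The Serre elements for the `e_i` act as zero. -/
lemma wordData_serreE (hA : IsGeneralizedCartanMatrix A) : (wordData r lam).SerreE := by
  intro i j hij
  set X := ((LieAlgebra.ad ℂ (Module.End ℂ (List ι →₀ ℂ)) ((wordData r lam).E i)) ^
    (1 - A i j).toNat) ((wordData r lam).E j) with hX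
  -- An operator commuting with every `f_k` is determined by its value on the empty word, and that
  -- word is killed by all the `e_k`.
  have hcomm : ∀ k t, X (wordF k t) = wordF k (X t) := by
    intro k t
    have := (wordData r lam).swap.lie_E_serre hA hij k
    have h2 : wordF k * X - X * wordF k = 0 := this
    exact (sub_eq_zero.1 (LinearMap.congr_fun h2 t)).symm
  have hnil : ∀ n : ℕ, ((LieAlgebra.ad ℂ (Module.End ℂ (List ι →₀ ℂ)) ((wordData r lam).E i)) ^ n)
      ((wordData r lam).E j) (Finsupp.single [] 1) = 0 := by
    have h0 : ∀ k, (wordData r lam).E k (Finsupp.single [] 1) = 0 := fun k =>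
      (wordE_single r lam k []).trans rfl
    intro n
    induction n with
    | zero => exact h0 j
    | succ n ih =>
      rw [pow_succ', Module.End.mul_apply, LieAlgebra.ad_apply, Ring.lie_def, LinearMap.sub_apply,
        Module.End.mul_apply, Module.End.mul_apply, ih, h0, map_zero, map_zero, sub_zero]
  refine end_ext_words fun w => ?_
  induction w with
  | nil => exact hnil _
  | cons k w ih =>
    rw [← wordF_single, hcomm, ih]; simp

/-- The Serre element `(ad f_i)^{1 - a_ij} f_j` acting on words. -/
noncomputable def wordSerre (i j : ι) : Module.End ℂ (List ι →₀ ℂ) :=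
  ((LieAlgebra.ad ℂ (Module.End ℂ (List ι →₀ ℂ)) ((wordData r lam).F i)) ^
    (1 - A i j).toNat) ((wordData r lam).F j)

/-- Generators of the left ideal of multiples of Serre elements. -/
inductive SerreMultiple : (List ι →₀ ℂ) → Prop
  | base (i j : ι) (hij : i ≠ j) (t : List ι →₀ ℂ) : SerreMultiple (wordSerre r lam i j t)
  | step (k : ι) {t : List ι →₀ ℂ} (ht : SerreMultiple t) : SerreMultiple (wordF k t)

/-- The two-sided ideal generated by the Serre elements. -/
noncomputable def serreSubmodule : Submodule ℂ (List ι →₀ ℂ) :=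
  Submodule.span ℂ {t | SerreMultiple r lam t}

variable {r lam}

lemma wordF_mem_serreSubmodule (k : ι) {t : List ι →₀ ℂ} (ht : t ∈ serreSubmodule r lam) :
    wordF k t ∈ serreSubmodule r lam := by
  have : serreSubmodule r lam ≤ (serreSubmodule r lam).comap (wordF k) :=
    Submodule.span_le.2 fun t ht => Submodule.subset_span (SerreMultiple.step k ht)
  exact this ht

lemma wordH_mem_serreSubmodule (x : 𝔥) {t : List ι →₀ ℂ} (ht : t ∈ serreSubmodule r lam) :
    wordH r lam x t ∈ serreSubmodule r lam := by
  have : serreSubmodule r lam ≤ (serreSubmodule r lam).comap (wordH r lam x) := by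
    refine Submodule.span_le.2 fun t ht => ?_
    change wordH r lam x t ∈ serreSubmodule r lam
    induction ht with
    | base i j hij t =>
      have hw : (wordData r lam).F j ∈ (wordData r lam).weightSpace
          (Module.End ℂ (List ι →₀ ℂ)) (-r.root j) := by
        intro x; rw [(wordData r lam).lie_H_F, LinearMap.neg_apply, neg_smul]
      have h := (wordData r lam).opF_pow_mem hw i (1 - A i j).toNat x
      have h2 : wordH r lam x * wordSerre r lam i j - wordSerre r lam i j * wordH r lam x =
        (-r.root j - (1 - A i j).toNat • r.root i) x • wordSerre r lam i j := h
      have h' := LinearMap.congr_fun h2 t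
      rw [LinearMap.sub_apply, Module.End.mul_apply, Module.End.mul_apply,
        sub_eq_iff_eq_add] at h'
      refine h'.symm ▸ add_mem ?_ ?_
      · exact Submodule.smul_mem _ _ (Submodule.subset_span (.base i j hij t))
      · exact Submodule.subset_span (.base i j hij _)
    | step k ht ih =>
      rw [wordH_wordF]
      exact sub_mem (wordF_mem_serreSubmodule k ih)
        (Submodule.smul_mem _ _ (Submodule.subset_span (SerreMultiple.step k ht)))
  exact this ht

lemma wordE_mem_serreSubmodule (hA : IsGeneralizedCartanMatrix A) (k : ι) {t : List ι →₀ ℂ}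
    (ht : t ∈ serreSubmodule r lam) : wordE r lam k t ∈ serreSubmodule r lam := by
  have : serreSubmodule r lam ≤ (serreSubmodule r lam).comap (wordE r lam k) := by
    refine Submodule.span_le.2 fun t ht => ?_
    change wordE r lam k t ∈ serreSubmodule r lam
    induction ht with
    | base i j hij t =>
      have h := LinearMap.congr_fun ((wordData r lam).lie_E_serre hA hij k) t
      rw [Ring.lie_def, LinearMap.sub_apply, LinearMap.zero_apply, sub_eq_zero] at h
      exact h.symm ▸ Submodule.subset_span (.base i j hij _)
    | step l ht ih =>
      rw [wordE_wordF]
      refine add_mem (wordF_mem_serreSubmodule l ih) ?_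
      split_ifs
      · exact wordH_mem_serreSubmodule _ (Submodule.subset_span ht)
      · exact zero_mem _
  exact this ht

/-- Every term of a generator begins with some `f`. Hence the highest weight vector survives modulo
the Serre submodule. -/
lemma serreSubmodule_apply_nil {t : List ι →₀ ℂ} (ht : t ∈ serreSubmodule r lam) : t [] = 0 := by
  have hF : ∀ k (t : List ι →₀ ℂ), wordF k t [] = 0 := by
    intro k t
    exact Finsupp.mapDomain_of_notMem_range _ _ (by simp)
  have : serreSubmodule r lam ≤ LinearMap.ker (Finsupp.lapply (R := ℂ) ([] : List ι)) := by
    refine Submodule.span_le.2 fun t ht => ?_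
    change t [] = 0
    cases ht with
    | base i j hij t =>
      have : ∀ n : ℕ, ∀ t, ((LieAlgebra.ad ℂ (Module.End ℂ (List ι →₀ ℂ))
          ((wordData r lam).F i)) ^ n) ((wordData r lam).F j) t [] = 0 := by
        intro n
        induction n with
        | zero => exact hF j
        | succ n ih =>
          intro t
          rw [pow_succ', Module.End.mul_apply, LieAlgebra.ad_apply, Ring.lie_def,
            LinearMap.sub_apply, Finsupp.sub_apply, Module.End.mul_apply, Module.End.mul_apply, ih,
            sub_zero]
          exact hF i _
      exact this _ t
    | step k ht => exact hF k _
  exact this ht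

end VermaModule

/-! ### The algebra `\bar 𝔤(A)`, its involution and its maximal ideal. -/

section SerreAlgebra

lemma free_mem_of_gen {ι 𝔥 : Type*} (K : LieSubalgebra ℂ (Free ι 𝔥))
    (h : ∀ g : Gen ι 𝔥, FreeLieAlgebra.of ℂ g ∈ K) (x : Free ι 𝔥) : x ∈ K := by
  let φ : Free ι 𝔥 →ₗ⁅ℂ⁆ K := FreeLieAlgebra.lift ℂ fun g => ⟨_, h g⟩
  have : K.incl.comp φ = LieHom.id := FreeLieAlgebra.hom_ext fun g => by simp [φ]
  have h2 : (φ x : Free ι 𝔥) = x := LieHom.congr_fun this x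
  rw [← h2]; exact (φ x).2

variable {ι : Type*} [Fintype ι] {A : Matrix ι ι ℤ}
variable {𝔥 : Type*} [AddCommGroup 𝔥] [Module ℂ 𝔥] (r : Realization A 𝔥)

/-- The quotient homomorphism by an ideal. -/
def quotientHom {L : Type*} [LieRing L] [LieAlgebra ℂ L] (I : LieIdeal ℂ L) : L →ₗ⁅ℂ⁆ L ⧸ I :=
  { I.toSubmodule.mkQ with map_lie' := rfl }

lemma quotientHom_surjective {L : Type*} [LieRing L] [LieAlgebra ℂ L] (I : LieIdeal ℂ L) :
    Function.Surjective (quotientHom I) := Submodule.mkQ_surjective _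

lemma quotientHom_eq_zero {L : Type*} [LieRing L] [LieAlgebra ℂ L] {I : LieIdeal ℂ L} {x : L} :
    quotientHom I x = 0 ↔ x ∈ I := LieSubmodule.Quotient.mk_eq_zero'

/-- A homomorphism killing an ideal factors through the quotient. -/
def quotientLift {L L' : Type*} [LieRing L] [LieAlgebra ℂ L] [LieRing L'] [LieAlgebra ℂ L']
    (I : LieIdeal ℂ L) (φ : L →ₗ⁅ℂ⁆ L') (h : ∀ x ∈ I, φ x = 0) : L ⧸ I →ₗ⁅ℂ⁆ L' :=
  { I.toSubmodule.liftQ (φ : L →ₗ[ℂ] L') h with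
    map_lie' := by
      intro x y
      obtain ⟨x, rfl⟩ := quotientHom_surjective I x
      obtain ⟨y, rfl⟩ := quotientHom_surjective I y
      exact LieHom.map_lie φ x y }

variable {r} in
lemma Relator.mk_eq_zero {x : Free ι 𝔥} (h : Relator r x) :
    quotientHom (relIdeal r) x = 0 :=
  quotientHom_eq_zero.2 (LieSubmodule.subset_lieSpan h)

/-- The Chevalley generators of `\bar 𝔤(A)`. -/
noncomputable def serreData : ChevalleyData r (SerreAlgebra r) where
  E i := serreGen r (Gen.e i)
  F i := serreGen r (Gen.f i)
  H :=
    { toFun := fun x => serreGen r (Gen.h x)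
      map_add' := fun x y => by
        have := (Relator.h_add (r := r) x y).mk_eq_zero
        rw [map_sub, map_add] at this
        exact sub_eq_zero.1 this
      map_smul' := fun c x => by
        have := (Relator.h_smul (r := r) c x).mk_eq_zero
        rw [map_sub, map_smul] at this
        exact sub_eq_zero.1 this }
  lie_H_H x y := (Relator.h_h (r := r) x y).mk_eq_zero
  lie_E_F_same i := by
    have := (Relator.e_f_same (r := r) i).mk_eq_zero
    rw [map_sub] at this
    exact sub_eq_zero.1 this
  lie_E_F_ne i j hij := (Relator.e_f_ne (r := r) i j hij).mk_eq_zero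
  lie_H_E x i := by
    have := (Relator.h_e (r := r) x i).mk_eq_zero
    rw [map_sub, map_smul] at this
    exact sub_eq_zero.1 this
  lie_H_F x i := by
    have := (Relator.h_f (r := r) x i).mk_eq_zero
    rw [map_add, map_smul] at this
    exact eq_neg_of_add_eq_zero_left this

lemma serreData_serreE : (serreData r).SerreE := by
  intro i j hij
  have := (Relator.serre_e (r := r) i j hij).mk_eq_zero
  rwa [map_ad_pow] at this

lemma serreData_swap_serreE : (serreData r).swap.SerreE := by
  intro i j hij
  have := (Relator.serre_f (r := r) i j hij).mk_eq_zero
  rwa [map_ad_pow] at this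

lemma serreData_generates : (serreData r).Generates := by
  refine eq_top_iff.2 fun y _ => ?_
  obtain ⟨x, rfl⟩ := quotientHom_surjective _ y
  refine free_mem_of_gen ((LieSubalgebra.lieSpan ℂ (SerreAlgebra r) _).comap
    (quotientHom (relIdeal r))) (fun g => ?_) x
  cases g with
  | e i => exact LieSubalgebra.subset_lieSpan (.inl (.inl ⟨i, rfl⟩))
  | f i => exact LieSubalgebra.subset_lieSpan (.inl (.inr ⟨i, rfl⟩))
  | h x => exact LieSubalgebra.subset_lieSpan (.inr ⟨x, rfl⟩)

variable {r} {L : Type*} [LieRing L] [LieAlgebra ℂ L]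

/-- The homomorphism from the free Lie algebra given by Chevalley generators. -/
noncomputable def ChevalleyData.freeHom (D : ChevalleyData r L) : Free ι 𝔥 →ₗ⁅ℂ⁆ L :=
  FreeLieAlgebra.lift ℂ fun
    | .e i => D.E i
    | .f i => D.F i
    | .h x => D.H x

lemma ChevalleyData.freeHom_e (D : ChevalleyData r L) (i : ι) :
    D.freeHom (FreeLieAlgebra.of ℂ (.e i)) = D.E i := FreeLieAlgebra.lift_of_apply _ _

lemma ChevalleyData.freeHom_f (D : ChevalleyData r L) (i : ι) :
    D.freeHom (FreeLieAlgebra.of ℂ (.f i)) = D.F i := FreeLieAlgebra.lift_of_apply _ _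

lemma ChevalleyData.freeHom_h (D : ChevalleyData r L) (x : 𝔥) :
    D.freeHom (FreeLieAlgebra.of ℂ (.h x)) = D.H x := FreeLieAlgebra.lift_of_apply _ _

/-- An ideal containing the images of the Serre elements contains the images of all relators. -/
lemma ChevalleyData.freeHom_mem_of_relator (D : ChevalleyData r L) {x : Free ι 𝔥}
    (h : Relator r x) {W : Submodule ℂ L}
    (hE : ∀ i j, i ≠ j → ((LieAlgebra.ad ℂ L (D.E i)) ^ (1 - A i j).toNat) (D.E j) ∈ W)
    (hF : ∀ i j, i ≠ j → ((LieAlgebra.ad ℂ L (D.F i)) ^ (1 - A i j).toNat) (D.F j) ∈ W) :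
    D.freeHom x ∈ W := by
  cases h with
  | h_add x y => simp [freeHom_h]
  | h_smul c x => simp [freeHom_h]
  | h_h x y => simp [freeHom_h, D.lie_H_H]
  | e_f_same i => simp [freeHom_h, freeHom_e, freeHom_f, D.lie_E_F_same]
  | e_f_ne i j hij => simp [freeHom_e, freeHom_f, D.lie_E_F_ne i j hij]
  | h_e x i => simp [freeHom_h, freeHom_e, D.lie_H_E]
  | h_f x i => simp [freeHom_h, freeHom_f, D.lie_H_F]
  | serre_e i j hij => rw [map_ad_pow, freeHom_e, freeHom_e]; exact hE i j hij
  | serre_f i j hij => rw [map_ad_pow, freeHom_f, freeHom_f]; exact hF i j hij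

lemma ChevalleyData.freeHom_eq_zero (D : ChevalleyData r L) (hE : D.SerreE) (hF : D.swap.SerreE)
    (x : Free ι 𝔥) (hx : x ∈ relIdeal r) : D.freeHom x = 0 := by
  have : relIdeal r ≤ D.freeHom.ker := by
    refine LieSubmodule.lieSpan_le.2 fun x hx => ?_
    have := D.freeHom_mem_of_relator hx (W := ⊥) (fun i j hij => (Submodule.mem_bot ℂ).2 (hE i j hij))
      (fun i j hij => (Submodule.mem_bot ℂ).2 (hF i j hij))
    exact LieHom.mem_ker.2 ((Submodule.mem_bot ℂ).1 this)
  exact LieHom.mem_ker.1 (this hx)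

variable (r) in
/-- The involution of `\bar 𝔤(A)` with `e_i ↔ f_i` and `h ↦ -h`. -/
noncomputable def serreInvolution : SerreAlgebra r →ₗ⁅ℂ⁆ SerreAlgebra r :=
  quotientLift (relIdeal r) (serreData r).swap.freeHom
    ((serreData r).swap.freeHom_eq_zero (serreData_swap_serreE r) (by
      rw [ChevalleyData.swap_swap]; exact serreData_serreE r))

lemma serreInvolution_E (i : ι) : serreInvolution r ((serreData r).E i) = (serreData r).F i :=
  (serreData r).swap.freeHom_e i

lemma serreInvolution_F (i : ι) : serreInvolution r ((serreData r).F i) = (serreData r).E i :=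
  (serreData r).swap.freeHom_f i

lemma serreInvolution_H (x : 𝔥) : serreInvolution r ((serreData r).H x) = -(serreData r).H x :=
  (serreData r).swap.freeHom_h x

lemma serreInvolution_involutive (y : SerreAlgebra r) :
    serreInvolution r (serreInvolution r y) = y := by
  refine (serreData_generates r).hom_ext (φ := (serreInvolution r).comp (serreInvolution r))
    (ψ := LieHom.id) (fun i => ?_) (fun i => ?_) (fun x => ?_) y
  · simp [serreInvolution_E, serreInvolution_F]
  · simp [serreInvolution_E, serreInvolution_F]
  · simp [serreInvolution_H]

lemma serreInvolution_mem_maxIdeal {y : SerreAlgebra r} (hy : y ∈ maxIdeal r) :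
    serreInvolution r y ∈ maxIdeal r := by
  have : maxIdeal r ≤ LieIdeal.comap (serreInvolution r) (maxIdeal r) := by
    refine sSup_le fun I hI z hz => ?_
    rw [LieIdeal.mem_comap]
    have hmem : LieIdeal.comap (serreInvolution r) I ≤ maxIdeal r := by
      refine le_sSup fun x hx => ?_
      rw [LieIdeal.mem_comap] at hx
      refine hI x ?_
      have h := serreInvolution_H (r := r) x
      have h' : -(serreData r).H x ∈ I := h ▸ hx
      exact neg_mem_iff.1 h'
    refine hmem ?_
    rwa [LieIdeal.mem_comap, serreInvolution_involutive]
  exact LieIdeal.mem_comap.1 (this hy)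

/-- The image of `α_i^∨` in `\bar 𝔤(A)` is nonzero. -/
lemma serreData_coroot_ne_zero (hA : IsGeneralizedCartanMatrix A) (i : ι) :
    (serreData r).H (r.coroot i) ≠ 0 := by
  classical
  let _ : LieRing (Module.End ℂ (List ι →₀ ℂ)) := LieRing.ofAssociativeRing
  intro hcon
  have hmem : FreeLieAlgebra.of ℂ (Gen.h (r.coroot i)) ∈ relIdeal r := quotientHom_eq_zero.1 hcon
  have hlam : r.root i (r.coroot i) ≠ 0 := by rw [r.root_coroot, hA.diag]; norm_num
  -- The highest weight is chosen as `α_i`, so that `α_i^∨` acts on the empty word by `2 ≠ 0`.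
  let D := wordData r (r.root i)
  have hstab : ∀ x, ∀ t ∈ serreSubmodule r (r.root i),
      D.freeHom x t ∈ serreSubmodule r (r.root i) := by
    intro x
    refine free_mem_of_gen ((stabilizer (serreSubmodule r (r.root i))).comap D.freeHom)
      (fun g => ?_) x
    intro t ht
    change D.freeHom (FreeLieAlgebra.of ℂ g) t ∈ _
    cases g with
    | e i => rw [D.freeHom_e]; exact wordE_mem_serreSubmodule hA i ht
    | f i => rw [D.freeHom_f]; exact wordF_mem_serreSubmodule i ht
    | h x => rw [D.freeHom_h]; exact wordH_mem_serreSubmodule x ht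
  -- These are the operators that act as zero modulo the Serre submodule; its stability makes their
  -- preimage an ideal.
  let W : Submodule ℂ (Module.End ℂ (List ι →₀ ℂ)) :=
    { carrier := {X | ∀ t, X t ∈ serreSubmodule r (r.root i)}
      zero_mem' := fun t => zero_mem _
      add_mem' := fun ha hb t => add_mem (ha t) (hb t)
      smul_mem' := fun c X hX t => Submodule.smul_mem _ c (hX t) }
  let I : LieIdeal ℂ (Free ι 𝔥) :=
    { W.comap (D.freeHom : Free ι 𝔥 →ₗ[ℂ] Module.End ℂ (List ι →₀ ℂ)) with
      lie_mem := fun {x y} hy t => by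
        change ∀ t, D.freeHom y t ∈ _ at hy
        change D.freeHom ⁅x, y⁆ t ∈ _
        rw [LieHom.map_lie, Ring.lie_def, LinearMap.sub_apply, Module.End.mul_apply,
          Module.End.mul_apply]
        exact sub_mem (hstab x _ (hy t)) (hy _) }
  have hle : relIdeal r ≤ I := by
    refine LieSubmodule.lieSpan_le.2 fun x hx => ?_
    refine D.freeHom_mem_of_relator hx (W := W) (fun j k hjk => ?_) (fun j k hjk t => ?_)
    · rw [wordData_serreE r _ hA j k hjk]; exact zero_mem _
    · exact Submodule.subset_span (.base j k hjk t)
  have h1 : D.freeHom (FreeLieAlgebra.of ℂ (Gen.h (r.coroot i))) (Finsupp.single [] 1) ∈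
    serreSubmodule r (r.root i) := hle hmem (Finsupp.single [] 1)
  rw [D.freeHom_h] at h1
  have h2 := serreSubmodule_apply_nil h1
  have h3 : D.H (r.coroot i) (Finsupp.single [] 1) =
      r.root i (r.coroot i) • Finsupp.single [] 1 := wordH_single r (r.root i) _ []
  rw [h3] at h2
  simp at h2
  exact hlam h2

/-- An ideal not containing `e_i` has no component in the root space of `α_i`. -/
lemma ChevalleyData.Generates.ideal_le [DecidableEq ι] {D : ChevalleyData r L} (hD : D.Generates)
    (I : LieIdeal ℂ L) {i : ι} (hi : D.E i ∉ I) :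
    I.toSubmodule ≤ ⨆ (ν) (_ : ν ≠ r.root i), D.weightSpace L ν := by
  intro x hx
  have hspan : x ∈ Submodule.span ℂ {D.E i} ⊔ ⨆ (ν) (_ : ν ≠ r.root i), D.weightSpace L ν := by
    have : Submodule.span ℂ {m | ∃ c, D.TriangularWord c m} ≤
        Submodule.span ℂ {D.E i} ⊔ ⨆ (ν) (_ : ν ≠ r.root i), D.weightSpace L ν := by
      rw [Submodule.span_le]
      rintro m ⟨c, hc⟩
      -- The root space of `α_i` is spanned by `e_i` alone: a longer word has coordinate sum at
      -- least 2.
      by_cases h : c = Pi.single i 1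
      · refine Submodule.mem_sup_left ?_
        suffices m = D.E i by rw [this]; exact Submodule.mem_span_singleton_self _
        cases hc with
        | pos hm =>
          cases hm with
          | base k _ =>
            have : k = i := by
              by_contra hk
              have := congrFun h k
              rw [Pi.single_eq_same, Pi.single_eq_of_ne hk] at this
              omega
            rw [this]
          | @step k _ d y hy =>
            exfalso
            have h1 : ∑ l, (d + Pi.single k 1 : ι → ℤ) l = ∑ l, (Pi.single i 1 : ι → ℤ) l := by rw [h]
            simp [Finset.sum_add_distrib] at h1
            have h2 := (Finset.sum_eq_zero_iff_of_nonneg fun l _ => hy.nonneg l).1 h1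
            exact hy.ne_zero (funext fun l => h2 l (Finset.mem_univ l))
        | zero y =>
          have := congrFun h i
          simp at this
        | @neg d _ hm =>
          have h1 := congrFun h i
          have h2 := hm.nonneg i
          simp at h1 h2
          omega
      · refine Submodule.mem_sup_right ?_
        refine Submodule.mem_iSup_of_mem (latticePoint r c) (Submodule.mem_iSup_of_mem ?_
          hc.mem_weightSpace)
        intro h'
        refine h (latticePoint_injective r ?_)
        rw [h', latticePoint_single, one_smul]
    exact this (hD.span_triangularWord x)
  obtain ⟨a, ha, b, hb, rfl⟩ := Submodule.mem_sup.1 hspan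
  obtain ⟨t, rfl⟩ := Submodule.mem_span_singleton.1 ha
  -- Modulo `I`, `t • e_i` equals `-b`, which has no component of weight `α_i`. Independence of the
  -- weight spaces of `L ⧸ I` puts `t • e_i` in `I`, so `t = 0`.
  have hmap : ∀ ν, ∀ y ∈ D.weightSpace L ν, I.toSubmodule.mkQ y ∈ D.weightSpace (L ⧸ I) ν :=
    fun ν y hy z => congrArg I.toSubmodule.mkQ (hy z)
  have h1 : I.toSubmodule.mkQ b ∈ ⨆ (ν) (_ : ν ≠ r.root i), D.weightSpace (L ⧸ I) ν := by
    have : (⨆ (ν) (_ : ν ≠ r.root i), D.weightSpace L ν) ≤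
        (⨆ (ν) (_ : ν ≠ r.root i), D.weightSpace (L ⧸ I) ν).comap I.toSubmodule.mkQ := by
      refine iSup₂_le fun ν hν y hy => ?_
      exact Submodule.mem_iSup_of_mem ν (Submodule.mem_iSup_of_mem hν (hmap ν y hy))
    exact this hb
  have h2 : I.toSubmodule.mkQ (t • D.E i) ∈ D.weightSpace (L ⧸ I) (r.root i) :=
    hmap _ _ (Submodule.smul_mem _ _ fun z => D.lie_H_E z i)
  have h3 : I.toSubmodule.mkQ (t • D.E i) = -I.toSubmodule.mkQ b := by
    rw [eq_neg_iff_add_eq_zero, ← map_add]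
    exact (Submodule.Quotient.mk_eq_zero _).2 hx
  have h4 : I.toSubmodule.mkQ (t • D.E i) = 0 :=
    Submodule.disjoint_def.1 (D.iSupIndep_weightSpace (M := L ⧸ I) (r.root i)) _ h2
      (h3 ▸ neg_mem h1)
  have h5 : t • D.E i ∈ I := (Submodule.Quotient.mk_eq_zero _).1 h4
  have h6 : t = 0 := by
    by_contra ht
    refine hi ?_
    have := I.toSubmodule.smul_mem t⁻¹ h5
    rwa [smul_smul, inv_mul_cancel₀ ht, one_smul] at this
  rw [h6, zero_smul, zero_add]
  exact hb

/-- An ideal meeting `𝔥` trivially cannot contain `e_i`, since it would then contain `[e_i, f_i] =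
α_i^∨ ≠ 0`. So each such ideal lies in the sum of the weight spaces other than that of `α_i`, and
this bound passes to the sum of all of them. -/
lemma serreData_E_notMem_maxIdeal (hA : IsGeneralizedCartanMatrix A) (i : ι) :
    (serreData r).E i ∉ maxIdeal r := by
  classical
  intro hmem
  have hle : (maxIdeal r).toSubmodule ≤
      ⨆ (ν) (_ : ν ≠ r.root i), (serreData r).weightSpace (SerreAlgebra r) ν := by
    rw [maxIdeal, LieSubmodule.sSup_toSubmodule]
    refine sSup_le ?_
    rintro _ ⟨I, hI, rfl⟩
    refine (serreData_generates r).ideal_le I fun hE => ?_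
    refine serreData_coroot_ne_zero hA i (hI _ ?_)
    have h : ⁅(serreData r).E i, (serreData r).F i⁆ ∈ I := lie_mem_left ℂ _ I _ _ hE
    rwa [(serreData r).lie_E_F_same] at h
  have h0 : (serreData r).E i = 0 := Submodule.disjoint_def.1
    ((serreData r).iSupIndep_weightSpace (M := SerreAlgebra r) (r.root i)) _
    (fun z => (serreData r).lie_H_E z i) (hle hmem)
  refine serreData_coroot_ne_zero (r := r) hA i ?_
  rw [← (serreData r).lie_E_F_same, h0, zero_lie]

end SerreAlgebra

/-! ### The Kac–Moody algebra. -/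

section Algebra

variable {ι : Type*} [Fintype ι] {A : Matrix ι ι ℤ}
variable {𝔥 : Type*} [AddCommGroup 𝔥] [Module ℂ 𝔥] (r : Realization A 𝔥)

/-- The Chevalley generators of the Kac–Moody algebra. -/
noncomputable def chevalleyData : ChevalleyData r (Algebra r) :=
  (serreData r).map (quotientHom (maxIdeal r))

lemma chevalleyData_generates : (chevalleyData r).Generates :=
  (serreData_generates r).map _ (quotientHom_surjective _)

lemma chevalleyData_serreE : (chevalleyData r).SerreE := (serreData_serreE r).map _

lemma chevalleyData_swap_serreE : (chevalleyData r).swap.SerreE :=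
  (serreData_swap_serreE r).map (quotientHom (maxIdeal r))

lemma chevalleyData_E_ne_zero (hA : IsGeneralizedCartanMatrix A) (i : ι) :
    (chevalleyData r).E i ≠ 0 := fun h =>
  serreData_E_notMem_maxIdeal hA i (quotientHom_eq_zero.1 h)

/-- The involution of `𝔤(A)` with `e_i ↔ f_i` and `h ↦ -h`. -/
noncomputable def involution : Algebra r →ₗ⁅ℂ⁆ Algebra r :=
  quotientLift (maxIdeal r) ((quotientHom (maxIdeal r)).comp (serreInvolution r))
    fun _ hx => quotientHom_eq_zero.2 (serreInvolution_mem_maxIdeal hx)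

lemma involution_involutive (y : Algebra r) : involution r (involution r y) = y := by
  obtain ⟨y, rfl⟩ := quotientHom_surjective _ y
  exact congrArg (quotientHom (maxIdeal r)) (serreInvolution_involutive y)

lemma involution_H (x : 𝔥) :
    involution r ((chevalleyData r).H x) = -(chevalleyData r).H x :=
  congrArg (quotientHom (maxIdeal r)) (serreInvolution_H x)

/-- This is the symmetry `Δ = -Δ`. It turns the weights of `f`-brackets acting on `V` into negatives
of positive roots. -/
lemma chevalleyData_swap_isRoot {c : ι → ℤ} (hc : (chevalleyData r).swap.IsRoot c) :
    (chevalleyData r).IsRoot c := by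
  obtain ⟨h0, y, hy, hy0⟩ := hc
  refine ⟨h0, involution r y, fun x => ?_, fun h => hy0 ?_⟩
  · have := congrArg (involution r) (hy x)
    rw [ChevalleyData.swap_H, LinearMap.neg_apply, LieHom.map_lie, map_neg, involution_H,
      map_smul, neg_neg] at this
    exact this
  · rw [← involution_involutive r y, h, map_zero]

end Algebra

end KacMoody

/-! ### Translation between subsets of `𝔥^*` and coordinates. -/

namespace KacMoody

section Translation

variable {ι : Type*} [Fintype ι] {A : Matrix ι ι ℤ}
variable {𝔥 : Type*} [AddCommGroup 𝔥] [Module ℂ 𝔥] {r : Realization A 𝔥} {J : Set ι}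
variable {V : Type*} [AddCommGroup V] [Module ℂ V]
variable [LieRingModule (Algebra r) V] [LieModule ℂ (Algebra r) V]

lemma mem_wt_iff {μ : Module.Dual ℂ 𝔥} :
    μ ∈ wt r V ↔ ∃ y ∈ (chevalleyData r).weightSpace V μ, y ≠ 0 :=
  ⟨fun ⟨y, h0, hy⟩ => ⟨y, hy, h0⟩, fun ⟨y, hy, h0⟩ => ⟨y, h0, hy⟩⟩

lemma mem_natSpan_simpleRoots {μ : Module.Dual ℂ 𝔥} : μ ∈ natSpan (simpleRoots r J) ↔
    ∃ c : ι → ℤ, 0 ≤ c ∧ (∀ i ∉ J, c i = 0) ∧ μ = latticePoint r c := by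
  classical
  constructor
  · intro h
    change μ ∈ AddSubmonoid.closure _ at h
    induction h using AddSubmonoid.closure_induction with
    | mem x hx =>
      obtain ⟨i, hi, rfl⟩ := hx
      refine ⟨Pi.single i 1, Pi.single_nonneg.2 zero_le_one, fun k hk => ?_, ?_⟩
      · exact Pi.single_eq_of_ne (by rintro rfl; exact hk hi) _
      · rw [latticePoint_single, one_smul]
    | zero => exact ⟨0, le_rfl, fun _ _ => rfl, (map_zero _).symm⟩
    | add x y _ _ hx hy =>
      obtain ⟨c, hc, hcJ, rfl⟩ := hx
      obtain ⟨d, hd, hdJ, rfl⟩ := hy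
      refine ⟨c + d, add_nonneg hc hd, fun i hi => ?_, (map_add _ _ _).symm⟩
      rw [Pi.add_apply, hcJ i hi, hdJ i hi, add_zero]
  · rintro ⟨c, hc, hcJ, rfl⟩
    rw [latticePoint_apply]
    refine sum_mem fun i _ => ?_
    by_cases hi : i ∈ J
    · obtain ⟨n, hn⟩ := Int.eq_ofNat_of_zero_le (hc i)
      rw [hn, natCast_zsmul]
      exact nsmul_mem (AddSubmonoid.subset_closure (Set.mem_image_of_mem r.root hi)) n
    · rw [hcJ i hi, zero_smul]
      exact zero_mem (AddSubmonoid.closure _)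

lemma mem_closure_simpleRoots {c : ι → ℤ} :
    latticePoint r c ∈ AddSubgroup.closure (simpleRoots r J) ↔ ∀ i ∉ J, c i = 0 := by
  classical
  constructor
  · intro h
    obtain ⟨d, hd, hdc⟩ : ∃ d : ι → ℤ, (∀ i ∉ J, d i = 0) ∧ latticePoint r c = latticePoint r d := by
      generalize latticePoint r c = μ at h
      induction h using AddSubgroup.closure_induction with
      | mem x hx =>
        obtain ⟨i, hi, rfl⟩ := hx
        refine ⟨Pi.single i 1, fun k hk => ?_, ?_⟩
        · exact Pi.single_eq_of_ne (by rintro rfl; exact hk hi) _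
        · rw [latticePoint_single, one_smul]
      | zero => exact ⟨0, fun _ _ => rfl, (map_zero _).symm⟩
      | add x y _ _ hx hy =>
        obtain ⟨c, hcJ, rfl⟩ := hx
        obtain ⟨d, hdJ, rfl⟩ := hy
        refine ⟨c + d, fun i hi => ?_, (map_add _ _ _).symm⟩
        rw [Pi.add_apply, hcJ i hi, hdJ i hi, add_zero]
      | neg x _ hx =>
        obtain ⟨c, hcJ, rfl⟩ := hx
        refine ⟨-c, fun i hi => ?_, (map_neg _ _).symm⟩
        rw [Pi.neg_apply, hcJ i hi, neg_zero]
    rwa [latticePoint_injective r hdc]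
  · intro hcJ
    rw [latticePoint_apply]
    refine sum_mem fun i _ => ?_
    by_cases hi : i ∈ J
    · exact zsmul_mem (AddSubgroup.subset_closure (Set.mem_image_of_mem r.root hi)) _
    · rw [hcJ i hi, zero_smul]
      exact zero_mem (AddSubgroup.closure _)

lemma mem_roots_iff {β : Module.Dual ℂ 𝔥} :
    β ∈ roots r ↔ ∃ c, (chevalleyData r).IsRoot c ∧ β = latticePoint r c := by
  classical
  constructor
  · rintro ⟨h, h0⟩
    obtain ⟨y, hy, hy0⟩ := mem_wt_iff.1 h
    obtain ⟨c, x, rfl, -⟩ := (chevalleyData_generates r).exists_triangularWord hy hy0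
    refine ⟨c, ⟨?_, y, hy, hy0⟩, rfl⟩
    rintro rfl
    exact h0 (map_zero _)
  · rintro ⟨c, ⟨h0, h⟩, rfl⟩
    refine ⟨mem_wt_iff.2 h, fun h' => h0 (latticePoint_injective r ?_)⟩
    rw [map_zero]; exact h'

/-- Linear independence identifies the complex coefficients with the integral ones. Positivity is
automatic: height 1 forces some positive coefficient, and a root has coefficients of one sign. -/
lemma mem_rootsOfHeight_iff {β : Module.Dual ℂ 𝔥} : β ∈ rootsOfHeight r Jᶜ 1 ↔
    ∃ c, (chevalleyData r).IsOuterRoot J c ∧ β = latticePoint r c := by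
  classical
  have hsum : ∀ c : ι → ℤ, ∑ i, Jᶜ.indicator (fun i => (c i : ℂ)) i = (outerHeight J c : ℤ) := by
    intro c
    rw [outerHeight_apply]
    push_cast
    refine Finset.sum_congr rfl fun i _ => ?_
    by_cases hi : i ∈ J <;> simp [hi]
  constructor
  · rintro ⟨hβ, c', hc', hs⟩
    obtain ⟨c, hc, rfl⟩ := mem_roots_iff.1 hβ
    have hcc : c' = fun i => (c i : ℂ) := by
      have h0 : ∑ i, (c' i - c i) • r.root i = 0 := by
        simp only [sub_smul, Finset.sum_sub_distrib]
        rw [← hc', ← latticePoint_eq_complex_sum, sub_self]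
      funext i
      exact sub_eq_zero.1 (Fintype.linearIndependent_iff.1 r.linearIndependent_root _ h0 i)
    rw [hcc, hsum] at hs
    have h1 : outerHeight J c = 1 := by exact_mod_cast hs
    obtain ⟨i, -, hi⟩ := exists_pos_of_outerHeight (J := J) (c := c) (by omega)
    exact ⟨c, ⟨hc, (chevalleyData_generates r).isRoot_nonneg hc ⟨i, hi⟩, h1⟩, rfl⟩
  · rintro ⟨c, ⟨hc, -, h1⟩, rfl⟩
    refine ⟨mem_roots_iff.2 ⟨c, hc, rfl⟩, fun i => (c i : ℂ), latticePoint_eq_complex_sum r c, ?_⟩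
    rw [hsum, h1]

lemma mem_posRoots_diff_iff {β : Module.Dual ℂ 𝔥} : β ∈ posRoots r \ posRootsSub r J ↔
    ∃ c, (chevalleyData r).IsRoot c ∧ 0 ≤ c ∧ 1 ≤ outerHeight J c ∧ β = latticePoint r c := by
  classical
  have hheight : ∀ c : ι → ℤ, 0 ≤ c → ((∀ i ∉ J, c i = 0) ↔ ¬ 1 ≤ outerHeight J c) := by
    intro c hc
    have h0 := outerHeight_nonneg (J := J) hc
    have h1 : outerHeight J c = 0 ↔ ∀ i ∉ J, c i = 0 := by
      rw [outerHeight_apply, Finset.sum_eq_zero_iff_of_nonneg]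
      · refine ⟨fun h i hi => ?_, fun h i _ => ?_⟩
        · simpa [hi] using h i (Finset.mem_univ i)
        · by_cases hi : i ∈ J
          · simp [hi]
          · simp [hi, h i hi]
      · intro i _
        split_ifs
        exacts [le_rfl, hc i]
    rw [← h1]
    omega
  constructor
  · rintro ⟨hp, hJ⟩
    obtain ⟨c, hc, rfl⟩ := mem_roots_iff.1 hp.1
    obtain ⟨d, hd, -, hcd⟩ := mem_natSpan_simpleRoots.1 hp.2
    obtain rfl := latticePoint_injective r hcd
    refine ⟨c, hc, hd, ?_, rfl⟩
    by_contra h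
    exact hJ ⟨hp, mem_closure_simpleRoots.2 ((hheight c hd).2 h)⟩
  · rintro ⟨c, hc, h0, h1, rfl⟩
    refine ⟨⟨mem_roots_iff.2 ⟨c, hc, rfl⟩, mem_natSpan_simpleRoots.2 ⟨c, h0, ?_, rfl⟩⟩, fun h => ?_⟩
    · exact fun i hi => absurd (Set.mem_univ i) hi
    · exact (hheight c h0).1 (mem_closure_simpleRoots.1 h.2) h1

lemma mem_natSpan_rootsOfHeight {μ : Module.Dual ℂ 𝔥} : μ ∈ natSpan (rootsOfHeight r Jᶜ 1) ↔
    ∃ S : Multiset (ι → ℤ), (∀ c ∈ S, (chevalleyData r).IsOuterRoot J c) ∧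
      μ = latticePoint r S.sum := by
  constructor
  · intro h
    change μ ∈ AddSubmonoid.closure _ at h
    induction h using AddSubmonoid.closure_induction with
    | mem x hx =>
      obtain ⟨c, hc, rfl⟩ := mem_rootsOfHeight_iff.1 hx
      exact ⟨{c}, by simpa using hc, by simp⟩
    | zero => exact ⟨0, by simp, by simp⟩
    | add x y _ _ hx hy =>
      obtain ⟨S, hS, rfl⟩ := hx
      obtain ⟨T, hT, rfl⟩ := hy
      refine ⟨S + T, fun c hc => ?_, by simp⟩
      exact (Multiset.mem_add.1 hc).elim (hS c) (hT c)
  · rintro ⟨S, hS, rfl⟩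
    rw [map_multiset_sum]
    refine multiset_sum_mem _ fun β hβ => ?_
    obtain ⟨c, hc, rfl⟩ := Multiset.mem_map.1 hβ
    exact AddSubmonoid.subset_closure (mem_rootsOfHeight_iff.2 ⟨c, hS c hc, rfl⟩)

/-- The positive roots outside the root system of `J` generate the same monoid as those in which
letters outside `J` occur once. -/
lemma natSpan_posRoots_diff :
    natSpan (posRoots r \ posRootsSub r J) = natSpan (rootsOfHeight r Jᶜ 1) := by
  classical
  refine congrArg SetLike.coe (le_antisymm (AddSubmonoid.closure_le.2 fun β hβ => ?_)
    (AddSubmonoid.closure_mono fun β hβ => ?_))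
  · obtain ⟨c, hc, -, h1, rfl⟩ := mem_posRoots_diff_iff.1 hβ
    obtain ⟨S, hS, rfl⟩ := (chevalleyData_generates r).exists_multiset hc h1
    exact mem_natSpan_rootsOfHeight.2 ⟨S, hS, rfl⟩
  · obtain ⟨c, ⟨hc, h0, h1⟩, rfl⟩ := mem_rootsOfHeight_iff.1 hβ
    exact mem_posRoots_diff_iff.2 ⟨c, hc, h0, h1.ge, rfl⟩

lemma simpleRoots_subset_rootsOfHeight (hA : IsGeneralizedCartanMatrix A) :
    simpleRoots r Jᶜ ⊆ rootsOfHeight r Jᶜ 1 := by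
  classical
  rintro _ ⟨i, hi, rfl⟩
  refine mem_rootsOfHeight_iff.2 ⟨Pi.single i 1, ?_, by rw [latticePoint_single, one_smul]⟩
  exact (ChevalleyData.Word.base i hi : (chevalleyData r).Word Jᶜ J _ _).isOuterRoot
    (chevalleyData_E_ne_zero r hA i)

lemma chevalleyData_isOuterRoot_of_swap {c : ι → ℤ}
    (hc : (chevalleyData r).swap.IsOuterRoot J c) : (chevalleyData r).IsOuterRoot J c :=
  ⟨chevalleyData_swap_isRoot r hc.1, hc.2⟩

variable {lam : Module.Dual ℂ 𝔥} {v : V}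

lemma mem_wt_iff_isDepth (hv : (chevalleyData r).IsHighestWeightVector lam v)
    {μ : Module.Dual ℂ 𝔥} :
    μ ∈ wt r V ↔ ∃ a, (chevalleyData r).IsDepth V lam a ∧ μ = lam - latticePoint r a := by
  classical
  constructor
  · intro h
    obtain ⟨y, hy, hy0⟩ := mem_wt_iff.1 h
    obtain ⟨a, m, rfl, -⟩ := hv.exists_vecWord (chevalleyData_generates r) hy hy0
    exact ⟨a, ⟨y, hy, hy0⟩, rfl⟩
  · rintro ⟨a, ha, rfl⟩
    exact mem_wt_iff.2 ha

lemma mem_wtSub_iff (hv : (chevalleyData r).IsHighestWeightVector lam v)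
    {μ : Module.Dual ℂ 𝔥} : μ ∈ wtSub r lam J V ↔
      ∃ a, (chevalleyData r).IsDepth V lam a ∧ (∀ i ∉ J, a i = 0) ∧
        μ = lam - latticePoint r a := by
  classical
  constructor
  · rintro ⟨h, l, rfl, s, hs, rfl⟩
    obtain ⟨c, -, hcJ, rfl⟩ := mem_natSpan_simpleRoots.1 hs
    exact ⟨c, mem_wt_iff.1 h, hcJ, rfl⟩
  · rintro ⟨a, ha, haJ, rfl⟩
    exact ⟨mem_wt_iff.2 ha, lam, rfl, _, mem_natSpan_simpleRoots.2
      ⟨a, hv.isDepth_nonneg (chevalleyData_generates r) ha, haJ, rfl⟩, rfl⟩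

/-- All weights lie in `wt_J V - ℤ_{≥0} Δ_{J^c,1}`. -/
lemma wt_subset (hv : (chevalleyData r).IsHighestWeightVector lam v) (J : Set ι) :
    wt r V ⊆ wtSub r lam J V - natSpan (rootsOfHeight r Jᶜ 1) := by
  classical
  intro μ hμ
  obtain ⟨c, hc, rfl⟩ := (mem_wt_iff_isDepth hv).1 hμ
  obtain ⟨a, ha, haJ, S, hS, rfl⟩ := hv.exists_multiset (chevalleyData_generates r) J hc
  refine ⟨_, (mem_wtSub_iff hv).2 ⟨a, ha, haJ, rfl⟩, _, mem_natSpan_rootsOfHeight.2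
    ⟨S, fun d hd => chevalleyData_isOuterRoot_of_swap (hS d hd), rfl⟩, ?_⟩
  rw [map_add, ← sub_sub]

lemma wtSub_sub_simpleRoots_subset_iff (hv : (chevalleyData r).IsHighestWeightVector lam v) :
    wtSub r lam J V - natSpan (simpleRoots r Jᶜ) ⊆ wt r V ↔
      ∀ a b, (chevalleyData r).IsDepth V lam a → (∀ i ∉ J, a i = 0) → 0 ≤ b →
        (∀ i ∈ J, b i = 0) → (chevalleyData r).IsDepth V lam (a + b) := by
  constructor
  · intro h a b ha haJ hb hbJ
    have := h (Set.sub_mem_sub ((mem_wtSub_iff hv).2 ⟨a, ha, haJ, rfl⟩)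
      (mem_natSpan_simpleRoots.2 ⟨b, hb, fun i hi => hbJ i (not_not.1 hi), rfl⟩))
    rw [sub_sub, ← map_add] at this
    exact mem_wt_iff.1 this
  · rintro h _ ⟨_, hμ, _, hs, rfl⟩
    obtain ⟨a, ha, haJ, rfl⟩ := (mem_wtSub_iff hv).1 hμ
    obtain ⟨b, hb, hbJ, rfl⟩ := mem_natSpan_simpleRoots.1 hs
    refine mem_wt_iff.2 ?_
    have := h a b ha haJ hb fun i hi => hbJ i (not_not.2 hi)
    rw [ChevalleyData.IsDepth, map_add, ← sub_sub] at this
    exact this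

/-- If `wt_J V - ℤ_{≥0} Π_{J^c}` consists of weights, then so does `wt_J V - ℤ_{≥0} Δ_{J^c,1}`. -/
lemma wt_eq_of_subset (hA : IsGeneralizedCartanMatrix A)
    (hv : (chevalleyData r).IsHighestWeightVector lam v)
    (h : wtSub r lam J V - natSpan (simpleRoots r Jᶜ) ⊆ wt r V) :
    wt r V = wtSub r lam J V - natSpan (rootsOfHeight r Jᶜ 1) := by
  classical
  refine Set.Subset.antisymm (wt_subset hv J) ?_
  rintro _ ⟨_, hμ, _, hs, rfl⟩
  obtain ⟨a, ha, haJ, rfl⟩ := (mem_wtSub_iff hv).1 hμ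
  obtain ⟨S, hS, rfl⟩ := mem_natSpan_rootsOfHeight.1 hs
  refine mem_wt_iff.2 ?_
  have := hv.isDepth_add_sum hA (chevalleyData_generates r) (chevalleyData_serreE r)
    (chevalleyData_swap_serreE r) ((wtSub_sub_simpleRoots_subset_iff hv).1 h) ha haJ S hS
  rw [ChevalleyData.IsDepth, map_add, ← sub_sub] at this
  exact this

end Translation

end KacMoody

theorem theoremC {ι : Type*} [Fintype ι] {A : Matrix ι ι ℤ} (hA : IsGeneralizedCartanMatrix A)
    {𝔥 : Type*} [AddCommGroup 𝔥] [Module ℂ 𝔥] (r : Realization A 𝔥)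
    (lam : Module.Dual ℂ 𝔥)
    {V : Type*} [AddCommGroup V] [Module ℂ V]
    [LieRingModule (KacMoody.Algebra r) V] [LieModule ℂ (KacMoody.Algebra r) V]
    (hV : KacMoody.IsHighestWeightModule r lam V) :
    (KacMoody.wt r V =
        KacMoody.wtSub r lam (KacMoody.integralSet r lam) V -
          KacMoody.natSpan (KacMoody.rootsOfHeight r (KacMoody.integralSet r lam)ᶜ 1) ∧
      KacMoody.wt r V =
        KacMoody.wtSub r lam (KacMoody.integralSet r lam) V -
          KacMoody.natSpan
            (KacMoody.posRoots r \ KacMoody.posRootsSub r (KacMoody.integralSet r lam))) ∧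
    ∀ J : Set ι,
      KacMoody.wtSub r lam J V - KacMoody.natSpan (KacMoody.simpleRoots r Jᶜ) ⊆ KacMoody.wt r V ↔
        KacMoody.wt r V =
          KacMoody.wtSub r lam J V - KacMoody.natSpan (KacMoody.rootsOfHeight r Jᶜ 1) := by
  classical
  obtain ⟨v, hv0, hvE, hvH, hvs⟩ := hV
  have hv : (KacMoody.chevalleyData r).IsHighestWeightVector lam v := ⟨hv0, hvE, hvH, hvs⟩
  have hlam : KacMoody.wt r V =
      KacMoody.wtSub r lam (KacMoody.integralSet r lam) V -
        KacMoody.natSpan (KacMoody.rootsOfHeight r (KacMoody.integralSet r lam)ᶜ 1) := by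
    refine KacMoody.wt_eq_of_subset hA hv ((KacMoody.wtSub_sub_simpleRoots_subset_iff hv).2 ?_)
    intro a b ha haJ hb hbJ
    exact hv.isDepth_add_of_not_integral hA (KacMoody.chevalleyData_generates r)
      (J := KacMoody.integralSet r lam) (fun i hi n h => hi ⟨n, h⟩) ha haJ hb hbJ
  refine ⟨⟨hlam, by rw [KacMoody.natSpan_posRoots_diff]; exact hlam⟩, fun J =>
    ⟨KacMoody.wt_eq_of_subset hA hv, fun h => ?_⟩⟩
  -- The simple roots outside `J` are themselves roots of height 1 outside `J`, so the left side is
  -- a subset of the description of `wt V`.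
  conv_rhs => rw [h]
  exact Set.sub_subset_sub_left
    (AddSubmonoid.closure_mono (KacMoody.simpleRoots_subset_rootsOfHeight hA))
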